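/- Let $\tau_L>0$, $\delta_L>0$, $\delta_R>0$, $\tau_R\in\mathbb R$, and put $f_L(x,y)=(\tau_L x+y+1,\,-\delta_L x)$, $f_R(x,y)=(\tau_R x+y+1,\,-\delta_R x)$, with $f=f_L$ for $x\le 0$ and $f=f_R$ for $x\ge 0$ (so $f$ is a homeomorphism of $\mathbb R^2$). Let $\Sigma$ be the $y$-axis, $\Pi_L=\{x\le 0\}$, $\Pi_R=\{x\ge 0\}$, $\Phi=\{(x,y): x<0,\ y\le 0\}$, $\Phi_{\rm pre}=\bigcup_{n\ge 1}f^{-n}(\Phi)$ and $\Phi_0=\Phi_{\rm pre}\cap\Phi$. The induced map $F:\Phi_0\to\Phi$ is $F(Z)=f^n(Z)$ for the smallest $n\ge 1$ with $f^n(Z)\in\Phi$. Let $\chi_L(Z)$ be the smallest $i\ge 1$ with $f^i(Z)\notin\Pi_L$ and $\chi_R(Z)$ the smallest $j\ge1$ with $f^j(Z)\notin\Pi_R$, when they exist. For $i\ge 1$ the set $f_L^{-i}(\Sigma)$ is a line; if it is not vertical, write it as $y=m_ix+c_i$. Let $p^*\in\{1,2,\ldots\}\cup\{\infty\}$ be the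 smallest $i\ge1$ for which $m_i\ge 0$ ($p^*=\infty$ if there is none), and let $p_{\min},p_{\max}$ be integers with $1\le p_{\min}<p_{\max}\le p^*$. Let $S=(0,c_{p_{\max}})$, $T=(0,c_{p_{\min}})$, and $$\Omega=\Big\{(x,y)\in\Phi:\ \tfrac{c_{p_{\max}}+1}{c_{p_{\max}}}(c_{p_{\max}}-y)\le x\le \tfrac{c_{p_{\min}}+1}{c_{p_{\min}}}(c_{p_{\min}}-y)\Big\},$$ the part in $\Phi$ of the quadrilateral with vertices $S,T,f(S),f(T)$ (a triangle if $p_{\min}=1$). Assume $f(S),f(T)\in\Phi_{\rm pre}$. Then for $X\in\{S,T\}$ the numbers $\chi_L(X)$ and $q_X=\chi_R\big(f_L^{\chi_L(X)}(X)\big)$ exist, and we write $F(X)=f_R^{q_X}\big(f_L^{\chi_L(X)}(X)\big)$. Let $q_{\min}=\min\{q_S,q_T\}$ and $q_{\max}=\max\{q_S,q_T\}+1$. Let $U$ be the point where the line through $F(S)$ and $f^{-1}(F(S))$ meets $\Sigma$, and $V$ the point where the line through $F(T)$ and $f^{-1}(F(T))$ meets $\Sigma$. With $\pi_1,\pi_2$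 the coordinate projections, assume further that $$\pi_2(U)>\pi_2(S),\qquad \pi_2(V)<\pi_2(T),$$ $$\pi_1(f(S))\,\pi_2(F(S))+\pi_2(S)\,\pi_1(F(S))<\pi_1(f(S))\,\pi_2(S),$$ $$\pi_1(f(T))\,\pi_2(F(T))+\pi_2(T)\,\pi_1(F(T))>\pi_1(f(T))\,\pi_2(T).$$ Then $\Omega\subseteq\Phi_0$, $F(\Omega)\subseteq\Omega$, and for every $Z\in\Omega$ the numbers $\chi_L(Z)$ and $\chi_R\big(f_L^{\chi_L(Z)}(Z)\big)$ exist and satisfy $$p_{\min}\le\chi_L(Z)\le p_{\max},\qquad q_{\min}\le\chi_R\big(f_L^{\chi_L(Z)}(Z)\big)\le q_{\max}.$$ -/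

import Mathlib

open Set
open scoped Affine

/-- The four real parameters of the two-dimensional border-collision normal form (with `μ = 1`). -/
structure BCNF where
  τL : ℝ
  δL : ℝ
  τR : ℝ
  δR : ℝ

namespace BCNF

/-- The switching manifold `Σ`: the `y`-axis. -/
def sigma : Set (ℝ × ℝ) := {z | z.1 = 0}

/-- The closed left half-plane. -/
def PiL : Set (ℝ × ℝ) := {z | z.1 ≤ 0}

/-- The closed right half-plane. -/
def PiR : Set (ℝ × ℝ) := {z | 0 ≤ z.1}

/-- `Φ`: the closed third quadrant without the `y`-axis. -/
def Phi : Set (ℝ × ℝ) := {z | z.1 < 0 ∧ z.2 ≤ 0}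

/-- `f_L(Z) = A_L Z + (1, 0)` with `A_L = [[τ_L, 1], [-δ_L, 0]]`. -/
def fL (P : BCNF) (z : ℝ × ℝ) : ℝ × ℝ := (P.τL * z.1 + z.2 + 1, -P.δL * z.1)

/-- `f_R(Z) = A_R Z + (1, 0)` with `A_R = [[τ_R, 1], [-δ_R, 0]]`. -/
def fR (P : BCNF) (z : ℝ × ℝ) : ℝ × ℝ := (P.τR * z.1 + z.2 + 1, -P.δR * z.1)

open Classical in
/-- The border-collision normal form with `μ = 1` (both pieces agree on `x = 0`). -/
noncomputable def f (P : BCNF) (z : ℝ × ℝ) : ℝ × ℝ :=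
  if z.1 ≤ 0 then P.fL z else P.fR z

open Classical in
/-- The inverse of `f`, for `δ_L, δ_R > 0` (see `f_fInv` and `fInv_f`). -/
noncomputable def fInv (P : BCNF) (z : ℝ × ℝ) : ℝ × ℝ :=
  if 0 ≤ z.2 then (-z.2 / P.δL, z.1 - P.τL * (-z.2 / P.δL) - 1)
  else (-z.2 / P.δR, z.1 - P.τR * (-z.2 / P.δR) - 1)

theorem f_fInv (P : BCNF) (hL : 0 < P.δL) (hR : 0 < P.δR) (z : ℝ × ℝ) :
    P.f (P.fInv z) = z := by
  obtain ⟨x, y⟩ := z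
  by_cases h : 0 ≤ y
  · have h1 : -y / P.δL ≤ 0 := div_nonpos_of_nonpos_of_nonneg (by linarith) hL.le
    simp only [fInv, h, if_true, f, h1, fL, Prod.mk.injEq]
    constructor
    · ring
    · field_simp
  · have h1 : ¬ (-y / P.δR ≤ 0) := not_le.mpr (div_pos (by linarith) hR)
    simp only [fInv, h, if_false, f, h1, fR, Prod.mk.injEq]
    constructor
    · ring
    · field_simp

theorem fInv_f (P : BCNF) (hL : 0 < P.δL) (hR : 0 < P.δR) (z : ℝ × ℝ) :
    P.fInv (P.f z) = z := by
  obtain ⟨x, y⟩ := z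
  by_cases h : x ≤ 0
  · have h1 : 0 ≤ -P.δL * x := by nlinarith
    have h2 : -(-P.δL * x) / P.δL = x := by field_simp
    simp only [f, h, if_true, fL, fInv, h1, h2, Prod.mk.injEq, true_and]
    ring
  · have h1 : ¬ (0 ≤ -P.δR * x) := by push Not at h ⊢; nlinarith
    have h2 : -(-P.δR * x) / P.δR = x := by field_simp
    simp only [f, h, if_false, fR, fInv, h1, h2, Prod.mk.injEq, true_and]
    ring

/-- The points that eventually map to `Φ`. -/
def PhiPre (P : BCNF) : Set (ℝ × ℝ) := ⋃ n ∈ Ici 1, (P.f^[n]) ⁻¹' Phi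

/-- `Φ₀`, the domain of the induced map. -/
def Phi0 (P : BCNF) : Set (ℝ × ℝ) := P.PhiPre ∩ Phi

/-- The smallest `n ≥ 1` with `f^n(Z) ∈ Φ` (meaningful on `PhiPre`). -/
noncomputable def returnTime (P : BCNF) (z : ℝ × ℝ) : ℕ :=
  sInf {n : ℕ | 1 ≤ n ∧ P.f^[n] z ∈ Phi}

/-- The induced map `F` (meaningful on `Phi0`): the first return map to `Φ`. -/
noncomputable def F (P : BCNF) (z : ℝ × ℝ) : ℝ × ℝ := P.f^[P.returnTime z] z

/-- The `i ≥ 1` with `f^i(Z) ∉ Π_L`. -/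
def exitsL (P : BCNF) (z : ℝ × ℝ) : Set ℕ := {i : ℕ | 1 ≤ i ∧ P.f^[i] z ∉ PiL}

/-- The `j ≥ 1` with `f^j(Z) ∉ Π_R`. -/
def exitsR (P : BCNF) (z : ℝ × ℝ) : Set ℕ := {j : ℕ | 1 ≤ j ∧ P.f^[j] z ∉ PiR}

/-- `χ_L(Z)`: the smallest `i ≥ 1` with `f^i(Z) ∉ Π_L`; it exists iff `exitsL` is nonempty. -/
noncomputable def chiL (P : BCNF) (z : ℝ × ℝ) : ℕ := sInf (P.exitsL z)

/-- `χ_R(Z)`: the smallest `j ≥ 1` with `f^j(Z) ∉ Π_R`; it exists iff `exitsR` is nonempty. -/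
noncomputable def chiR (P : BCNF) (z : ℝ × ℝ) : ℕ := sInf (P.exitsR z)

/-- The preimage `f_L^{-i}(Σ)`, a line. -/
def preSigma (P : BCNF) (i : ℕ) : Set (ℝ × ℝ) := (P.fL^[i]) ⁻¹' sigma

/-- `f_L^{-i}(Σ)` is the (non-vertical) line `y = m x + c`. -/
def IsPreLine (P : BCNF) (i : ℕ) (m c : ℝ) : Prop :=
  P.preSigma i = {z | z.2 = m * z.1 + c}

/-- The constant term of the affine function `π₁ ∘ f_L^i`. -/
def coefK (P : BCNF) (i : ℕ) : ℝ := (P.fL^[i] (0, 0)).1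

/-- The `x`-coefficient of the affine function `π₁ ∘ f_L^i`. -/
def coefA (P : BCNF) (i : ℕ) : ℝ := (P.fL^[i] (1, 0)).1 - P.coefK i

/-- The `y`-coefficient of the affine function `π₁ ∘ f_L^i`. -/
def coefB (P : BCNF) (i : ℕ) : ℝ := (P.fL^[i] (0, 1)).1 - P.coefK i

/-- The slope `m_i` of `f_L^{-i}(Σ)`, when this line is not vertical (see `isPreLine_iff`). -/
noncomputable def slope (P : BCNF) (i : ℕ) : ℝ := -P.coefA i / P.coefB i

/-- The `y`-intercept `c_i` of `f_L^{-i}(Σ)`, when this line is not vertical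
(see `isPreLine_iff`). -/
noncomputable def yInt (P : BCNF) (i : ℕ) : ℝ := -P.coefK i / P.coefB i

theorem fL_iterate_fst (P : BCNF) (i : ℕ) (z : ℝ × ℝ) :
    (P.fL^[i] z).1 = P.coefA i * z.1 + P.coefB i * z.2 + P.coefK i := by
  have key : ∀ i : ℕ, ∀ z : ℝ × ℝ,
      (P.fL^[i] z).1 = ((P.fL^[i] (1, 0)).1 - (P.fL^[i] (0, 0)).1) * z.1
        + ((P.fL^[i] (0, 1)).1 - (P.fL^[i] (0, 0)).1) * z.2 + (P.fL^[i] (0, 0)).1 ∧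
      (P.fL^[i] z).2 = ((P.fL^[i] (1, 0)).2 - (P.fL^[i] (0, 0)).2) * z.1
        + ((P.fL^[i] (0, 1)).2 - (P.fL^[i] (0, 0)).2) * z.2 + (P.fL^[i] (0, 0)).2 := by
    intro i
    induction i with
    | zero => intro z; simp
    | succ n ih =>
      intro z
      obtain ⟨h1, h2⟩ := ih z
      simp only [Function.iterate_succ_apply', fL]
      rw [h1, h2]
      constructor <;> ring
  exact (key i z).1

/-- If `f_L^{-i}(Σ)` is a non-vertical line then `slope` and `yInt` are its slope and
`y`-intercept, and it is non-vertical iff `coefB i ≠ 0`. -/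
theorem isPreLine_iff (P : BCNF) (i : ℕ) (m c : ℝ) :
    P.IsPreLine i m c ↔ P.coefB i ≠ 0 ∧ m = P.slope i ∧ c = P.yInt i := by
  have mem : ∀ z : ℝ × ℝ, z ∈ P.preSigma i ↔
      P.coefA i * z.1 + P.coefB i * z.2 + P.coefK i = 0 := fun z => by
    rw [← fL_iterate_fst]; rfl
  constructor
  · intro h
    have hm : ∀ z : ℝ × ℝ, P.coefA i * z.1 + P.coefB i * z.2 + P.coefK i = 0 ↔
        z.2 = m * z.1 + c := fun z => by
      rw [← mem, h]; rfl
    have hc := (hm (0, c)).2 (by simp)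
    have h1 := (hm (1, m + c)).2 (by simp)
    simp only at hc h1
    have hB : P.coefB i ≠ 0 := by
      intro hB
      rw [hB] at hc
      have := (hm (0, c + 1)).1 (by simp only [hB]; linarith)
      simp at this
    refine ⟨hB, ?_, ?_⟩
    · rw [slope, eq_div_iff hB]; linarith
    · rw [yInt, eq_div_iff hB]; linarith
  · rintro ⟨hB, rfl, rfl⟩
    ext z
    rw [mem]
    simp only [mem_ofPred_eq, slope, yInt]
    field_simp
    constructor <;> intro h <;> linarith

/-- `p^*`: the smallest `i ≥ 1` with `m_i ≥ 0`, or `∞` if there is none. -/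
noncomputable def pStar (P : BCNF) : ℕ∞ :=
  sInf {n : ℕ∞ | ∃ i : ℕ, 1 ≤ i ∧ (∃ m c : ℝ, P.IsPreLine i m c ∧ 0 ≤ m) ∧ n = i}

/-- The point `(0, c_p)` on `Σ`: this is `S` for `p = p_max` and `T` for `p = p_min`. -/
noncomputable def corner (P : BCNF) (p : ℕ) : ℝ × ℝ := (0, P.yInt p)

/-- The quadrilateral `Ω` with vertices `S`, `T`, `f(S)`, `f(T)`, as a subset of `Φ`. -/
def Omega (P : BCNF) (pmin pmax : ℕ) : Set (ℝ × ℝ) :=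
  {z | z ∈ Phi ∧
    (P.yInt pmax + 1) / P.yInt pmax * (P.yInt pmax - z.2) ≤ z.1 ∧
    z.1 ≤ (P.yInt pmin + 1) / P.yInt pmin * (P.yInt pmin - z.2)}

/-- `χ_R(f_L^{χ_L(Z)}(Z))`. -/
noncomputable def chiRL (P : BCNF) (z : ℝ × ℝ) : ℕ := P.chiR (P.fL^[P.chiL z] z)

/-- `f_R^q(f_L^p(Z))` with `p = χ_L(Z)` and `q = χ_R(f_L^p(Z))`. On `Φ₀` this is the induced map;
for the points `S` and `T`, which lie on `Σ` and hence outside `Φ`, it is what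
`F(S)` and `F(T)` stand for. -/
noncomputable def FLR (P : BCNF) (z : ℝ × ℝ) : ℝ × ℝ :=
  P.fR^[P.chiRL z] (P.fL^[P.chiL z] z)

/-- The point at which the line through `A` and `B` meets `Σ` (when this line is not vertical,
see `eq_meetSigma_iff`). -/
noncomputable def meetSigma (A B : ℝ × ℝ) : ℝ × ℝ :=
  (0, A.2 - A.1 * ((B.2 - A.2) / (B.1 - A.1)))

theorem eq_meetSigma_iff (A B : ℝ × ℝ) (h : A.1 ≠ B.1) (U : ℝ × ℝ) :
    U = meetSigma A B ↔ U ∈ line[ℝ, A, B] ∧ U ∈ sigma := by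
  have h' : B.1 - A.1 ≠ 0 := sub_ne_zero.mpr (Ne.symm h)
  constructor
  · rintro rfl
    refine ⟨?_, rfl⟩
    have : meetSigma A B = AffineMap.lineMap A B (-A.1 / (B.1 - A.1)) := by
      ext
      · simp [meetSigma, AffineMap.lineMap_apply, h']
      · simp [meetSigma, AffineMap.lineMap_apply]
        ring
    rw [this]
    exact AffineMap.lineMap_mem_affineSpan_pair _ _ _
  · rintro ⟨hl, hs⟩
    obtain ⟨r, rfl⟩ := mem_affineSpan_pair_iff_exists_lineMap_eq.mp hl
    have hr : r * (B.1 - A.1) + A.1 = 0 := by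
      simpa [sigma, AffineMap.lineMap_apply] using hs
    have hr' : r = -A.1 / (B.1 - A.1) := by
      rw [eq_div_iff h']; linarith
    ext
    · simpa [meetSigma, AffineMap.lineMap_apply] using hr
    · simp [meetSigma, AffineMap.lineMap_apply, hr']
      ring

/-- The point at which the line through `F(Z)` and `f^{-1}(F(Z))` meets `Σ`: this is `U` for
`Z = S` and `V` for `Z = T`. -/
noncomputable def crossing (P : BCNF) (z : ℝ × ℝ) : ℝ × ℝ :=
  meetSigma (P.FLR z) (P.fInv (P.FLR z))

end BCNF

/-! Let U_i be the Lucas numbers of an affine piece with trace τ and determinant δ. The i-th iterate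
of (0, w) has abscissa U_i w + U_1 + … + U_i, and the edges of its orbit are the images of the
segment from (0, w) to (w + 1, 0).

Left half-plane. For i ≤ p^* the U_i are positive, the intercepts c_i decrease, and the height r_i
at which (0, c_i) returns to the axis after i steps increases. Hence a point of Ω first enters x > 0
in the strip between the edges starting at (0, t) and (0, s), where t and s are the landing heights
of T and S (`LucasPos.exists_departure`).

Right half-plane. The entry point W lies on a segment from (0, w) to (w + 1, 0) with t ≤ w ≤ s, so
its iterates lie on the edges of the orbit of (0, w). Let AB be the edge that leaves the right
half-plane. The return point of W lies either between B and the point where AB meets the axis, or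
between B and the image of that point. It therefore suffices that B lies between the two lines
bounding Ω and that AB meets the axis between S and T (`exists_return`).

The hypotheses say half of this for w = s (`PassesAbove`) and half for w = t (`PassesBelow`). Orbits
that exit turn clockwise and have unimodal abscissas, so each U_i up to the exit either is
nonpositive or comes with a positive partial sum. Consequently higher orbits exit no later, and both
properties spread over [t, s] by a comparison of edges at a fixed exit index. The index changes at
heights whose orbit hits the axis, where two consecutive edges share their crossing point
(`ExitsAt.passesBelow`, `ExitsAt.passesAbove`). -/

namespace BCNF

/-! ### Affine iterates, Lucas numbers and orientation. -/

/-- One affine piece of the border-collision normal form with trace `τ` and determinant `δ`. -/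
def step (τ δ : ℝ) (z : ℝ × ℝ) : ℝ × ℝ := (τ * z.1 + z.2 + 1, -δ * z.1)

/-- The Lucas sequence with parameters `τ` and `δ`. -/
def lucas (τ δ : ℝ) : ℕ → ℝ
  | 0 => 0
  | 1 => 1
  | n + 2 => τ * lucas τ δ (n + 1) - δ * lucas τ δ n

/-- The sum of the first `k` positive-index terms of the Lucas sequence. -/
def lucasSum (τ δ : ℝ) (k : ℕ) : ℝ := ∑ i ∈ Finset.range k, lucas τ δ (i + 1)

/-- Twice the signed area of the triangle `A B C`. -/
def turn (A B C : ℝ × ℝ) : ℝ := (B.1 - A.1) * (C.2 - A.2) - (B.2 - A.2) * (C.1 - A.1)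

/-- The orbit of the point `(0, w)` under `step`. -/
def orb (τ δ w : ℝ) (k : ℕ) : ℝ × ℝ := (step τ δ)^[k] (0, w)

/-- An affine function that vanishes on the line through `(0, c)` and its image `(c + 1, 0)`. -/
def edgeForm (c : ℝ) (z : ℝ × ℝ) : ℝ := (c + 1) * z.2 + c * z.1 - c * (c + 1)

variable {τ δ : ℝ}

@[simp] theorem lucasSum_zero : lucasSum τ δ 0 = 0 := by simp [lucasSum]

theorem lucasSum_succ (k : ℕ) : lucasSum τ δ (k + 1) = lucasSum τ δ k + lucas τ δ (k + 1) := by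
  simp [lucasSum, Finset.sum_range_succ]

/-- This identifies the i-th preimage of Σ: its slope is -U_{i+1}/U_i and its intercept is -(U_1 + …
+ U_i)/U_i. -/
theorem step_iterate_fst (k : ℕ) (z : ℝ × ℝ) :
    ((step τ δ)^[k] z).1 = lucas τ δ (k + 1) * z.1 + lucas τ δ k * z.2 + lucasSum τ δ k := by
  induction k generalizing z with
  | zero => simp [lucas]
  | succ n ih =>
    rw [Function.iterate_succ_apply, ih, lucasSum_succ]
    simp only [step, lucas]
    ring

theorem step_iterate_succ_snd (k : ℕ) (z : ℝ × ℝ) :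
    ((step τ δ)^[k + 1] z).2 = -δ * ((step τ δ)^[k] z).1 := by
  rw [Function.iterate_succ_apply']; rfl

theorem turn_step (A B C : ℝ × ℝ) :
    turn (step τ δ A) (step τ δ B) (step τ δ C) = δ * turn A B C := by
  simp only [turn, step]; ring

theorem turn_iterate (k : ℕ) (A B C : ℝ × ℝ) :
    turn ((step τ δ)^[k] A) ((step τ δ)^[k] B) ((step τ δ)^[k] C) = δ ^ k * turn A B C := by
  induction k with
  | zero => simp
  | succ n ih => simp only [Function.iterate_succ_apply', turn_step, ih, pow_succ]; ring

theorem step_iterate_combo (k : ℕ) (A B : ℝ × ℝ) {a b : ℝ} (hab : a + b = 1) :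
    (step τ δ)^[k] (a * A.1 + b * B.1, a * A.2 + b * B.2) =
      (a * ((step τ δ)^[k] A).1 + b * ((step τ δ)^[k] B).1,
        a * ((step τ δ)^[k] A).2 + b * ((step τ δ)^[k] B).2) := by
  induction k with
  | zero => rfl
  | succ n ih =>
    simp only [Function.iterate_succ_apply', ih]
    ext
    · simp only [step]; linear_combination -hab
    · simp only [step]; ring

theorem orb_zero (w : ℝ) : orb τ δ w 0 = (0, w) := rfl

theorem orb_one (w : ℝ) : orb τ δ w 1 = (w + 1, 0) := by simp [orb, step]

theorem orb_succ (w : ℝ) (k : ℕ) : orb τ δ w (k + 1) = step τ δ (orb τ δ w k) :=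
  Function.iterate_succ_apply' _ _ _

theorem orb_fst (w : ℝ) (k : ℕ) :
    (orb τ δ w k).1 = lucas τ δ k * w + lucasSum τ δ k := by
  simp [orb, step_iterate_fst]

theorem orb_succ_snd (w : ℝ) (k : ℕ) : (orb τ δ w (k + 1)).2 = -δ * (orb τ δ w k).1 :=
  step_iterate_succ_snd _ _

/-- Every edge is an image of the first one under a map of determinant δ, so orientation questions
about late edges reduce to the first edge. -/
theorem turn_orb (w w' : ℝ) (k n : ℕ) :
    turn (orb τ δ w k) (orb τ δ w (k + 1)) (orb τ δ w' (k + n)) =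
      δ ^ k * turn (orb τ δ w 0) (orb τ δ w 1) (orb τ δ w' n) := by
  have h : ∀ v m, orb τ δ v (k + m) = (step τ δ)^[k] (orb τ δ v m) := fun v m => by
    simp [orb, Function.iterate_add_apply]
  rw [h w' n, h w 1, ← turn_iterate]; rfl

theorem turn_orb_start (w w' : ℝ) :
    turn (orb τ δ w 0) (orb τ δ w 1) (orb τ δ w' 0) = (w + 1) * (w' - w) := by
  simp only [orb_zero, orb_one, turn]; ring

theorem turn_orb_next (w w' : ℝ) :
    turn (orb τ δ w 0) (orb τ δ w 1) (orb τ δ w' 1) = w * (w' - w) := by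
  simp only [orb_zero, orb_one, turn]; ring

/-! ### Convexity and unimodality of orbits in the right half-plane. -/

/-- If an orbit does not turn clockwise, it moves to the right for ever. -/
theorem orb_fst_lt_of_turn_nonneg (hδ : 0 < δ) {w : ℝ} (hw : 0 ≤ w)
    (h : 0 ≤ turn (orb τ δ w 0) (orb τ δ w 1) (orb τ δ w 2)) (k : ℕ) :
    (orb τ δ w k).1 < (orb τ δ w (k + 1)).1 := by
  have key : ∀ k, (orb τ δ w k).1 < (orb τ δ w (k + 1)).1 ∧
      (orb τ δ w (k + 1)).1 < (orb τ δ w (k + 2)).1 := by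
    intro k
    induction k with
    | zero =>
      have h2 : (orb τ δ w 2).2 = -δ * (w + 1) := by rw [orb_succ_snd, orb_one]
      simp only [zero_add]
      refine ⟨by simp only [orb_zero, orb_one]; linarith, ?_⟩
      simp only [turn, h2, orb_zero, orb_one] at h ⊢
      by_contra hc
      have : 0 < δ * (w + 1) ^ 2 := by positivity
      nlinarith
    | succ n ih =>
      refine ⟨ih.2, ?_⟩
      -- For successive increments d₁, d₂, d₃ of the abscissa, nonnegativity of this turn says d₁ d₃
      -- ≥ d₂², so d₃ > 0 once d₁, d₂ > 0.
      have h1 := turn_orb (τ := τ) (δ := δ) w w (n + 1) 2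
      have h2 : 0 ≤ δ ^ (n + 1) * turn (orb τ δ w 0) (orb τ δ w 1) (orb τ δ w 2) :=
        mul_nonneg (pow_nonneg hδ.le _) h
      rw [← h1] at h2
      have e1 := orb_succ_snd (τ := τ) (δ := δ) w n
      have e2 := orb_succ_snd (τ := τ) (δ := δ) w (n + 1)
      have e3 := orb_succ_snd (τ := τ) (δ := δ) w (n + 2)
      have e4 : n + 1 + 2 = n + 2 + 1 := rfl
      have e5 : n + 1 + 1 = n + 2 := rfl
      rw [e4, e5] at *
      simp only [turn, e1, e2, e3] at h2
      obtain ⟨i1, i2⟩ := ih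
      set x0 := (orb τ δ w n).1
      set x1 := (orb τ δ w (n + 1)).1
      set x2 := (orb τ δ w (n + 2)).1
      set x3 := (orb τ δ w (n + 2 + 1)).1
      by_contra hc
      have p1 : 0 < (x2 - x1) ^ 2 := by nlinarith
      have p2 : 0 ≤ (x1 - x0) * (x2 - x3) := mul_nonneg (by linarith) (by linarith)
      have : δ * ((x2 - x1) ^ 2 + (x1 - x0) * (x2 - x3)) ≤ 0 := by nlinarith
      have : 0 < δ * ((x2 - x1) ^ 2 + (x1 - x0) * (x2 - x3)) := mul_pos hδ (by linarith)
      linarith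
  exact (key k).1

theorem turn_orb_neg_of_exit (hδ : 0 < δ) {w : ℝ} (hw : 0 ≤ w) {n : ℕ}
    (hn : (orb τ δ w n).1 < 0) :
    turn (orb τ δ w 0) (orb τ δ w 1) (orb τ δ w 2) < 0 := by
  by_contra h
  have h1 := orb_fst_lt_of_turn_nonneg hδ hw (not_lt.mp h)
  have : 0 ≤ (orb τ δ w n).1 := by
    have := (strictMono_nat_of_lt_succ h1).monotone (Nat.zero_le n)
    simpa [orb_zero] using this
  linarith

/-- While it stays in the right half-plane, an orbit stays on the right of its first edge. -/
theorem turn_orb_nonpos (hδ : 0 < δ) {w : ℝ} (hw : 0 ≤ w)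
    (ht : turn (orb τ δ w 0) (orb τ δ w 1) (orb τ δ w 2) < 0) {n : ℕ} (hn : 1 ≤ n)
    (hx : ∀ k < n, 0 ≤ (orb τ δ w k).1) :
    turn (orb τ δ w 0) (orb τ δ w 1) (orb τ δ w n) ≤ 0 := by
  induction n, hn using Nat.le_induction with
  | base => simp [turn]; linarith
  | succ n hn ih =>
    have h1 := ih fun k hk => hx k (by omega)
    have h2 := turn_orb (τ := τ) (δ := δ) w w 1 n
    have h3 : (orb τ δ w (n + 1)).2 ≤ 0 := by
      rw [orb_succ_snd]; nlinarith [hx n (by omega)]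
    have h4 : (orb τ δ w 2).2 = -δ * (w + 1) := by rw [orb_succ_snd, orb_one]
    have h5 : δ ^ 1 * turn (orb τ δ w 0) (orb τ δ w 1) (orb τ δ w n) ≤ 0 :=
      mul_nonpos_of_nonneg_of_nonpos (by positivity) h1
    rw [← h2, add_comm 1 n] at h5
    simp only [turn, h4, orb_zero, orb_one, one_add_one_eq_two] at h5 ht ⊢
    set p := (orb τ δ w 2).1
    set x := (orb τ δ w (n + 1)).1
    set y := (orb τ δ w (n + 1)).2
    have h6 : 0 < δ * (w + 1) := by positivity
    -- The forms of the first two edges and the ordinate all vanish at (w + 1, 0), hence are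
    -- dependent: δ(w + 1) · first = w · second − turn · ordinate.
    have h7 : δ * (w + 1) * ((w + 1 - 0) * (y - w) - (0 - w) * (x - 0)) ≤ 0 := by
      nlinarith [mul_nonneg (neg_nonneg.2 ht.le) (neg_nonneg.2 h3)]
    exact nonpos_of_mul_nonpos_right h7 h6

/-- Along an orbit that leaves the right half-plane, the abscissa is unimodal up to the exit. -/
theorem orb_fst_antitone_step (hδ : 0 < δ) {w : ℝ} (hw : 0 ≤ w) {n m : ℕ}
    (hn : ∀ i ≤ n, 0 ≤ (orb τ δ w i).1) (hexit : (orb τ δ w (n + 1)).1 < 0) (hm : m + 1 ≤ n)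
    (hdec : (orb τ δ w (m + 1)).1 ≤ (orb τ δ w m).1) :
    (orb τ δ w (m + 2)).1 ≤ (orb τ δ w (m + 1)).1 := by
  by_contra! hinc
  have ht := turn_orb_neg_of_exit hδ hw hexit
  -- If a leftward edge AB is followed by a rightward edge BC, later points are confined to the
  -- right of both lines, a wedge in which no abscissa is below that of B; the orbit would then
  -- never exit.
  have hall : ∀ N, 0 ≤ (orb τ δ w N).1 := by
    intro N
    induction N using Nat.strong_induction_on with
    | _ N ih =>
      rcases le_or_gt N (m + 1) with hN | hN
      · exact hn N (by omega)
      have t1 : turn (orb τ δ w m) (orb τ δ w (m + 1)) (orb τ δ w N) ≤ 0 := by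
        have := turn_orb (τ := τ) (δ := δ) w w m (N - m)
        rw [show m + (N - m) = N by omega] at this
        rw [this]
        exact mul_nonpos_of_nonneg_of_nonpos (by positivity)
          (turn_orb_nonpos hδ hw ht (by omega) fun k hk => ih k (by omega))
      have t2 : turn (orb τ δ w (m + 1)) (orb τ δ w (m + 2)) (orb τ δ w N) ≤ 0 := by
        have := turn_orb (τ := τ) (δ := δ) w w (m + 1) (N - (m + 1))
        rw [show m + 1 + (N - (m + 1)) = N by omega] at this
        rw [this]
        exact mul_nonpos_of_nonneg_of_nonpos (by positivity)
          (turn_orb_nonpos hδ hw ht (by omega) fun k hk => ih k (by omega))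
      have t3 : turn (orb τ δ w m) (orb τ δ w (m + 1)) (orb τ δ w (m + 2)) < 0 := by
        rw [turn_orb w w m 2]
        exact mul_neg_of_pos_of_neg (by positivity) ht
      have hm0 := hn (m + 1) hm
      simp only [turn] at t1 t2 t3
      set A := orb τ δ w m
      set B := orb τ δ w (m + 1)
      set C := orb τ δ w (m + 2)
      set Z := orb τ δ w N
      have a1 : 0 ≤ A.1 - B.1 := by linarith
      have a2 : 0 < C.1 - B.1 := by linarith
      have := mul_nonpos_of_nonneg_of_nonpos a2.le t1
      have := mul_nonpos_of_nonneg_of_nonpos a1 t2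
      have : 0 ≤ Z.1 - B.1 := by
        by_contra! hc
        have := mul_pos_of_neg_of_neg hc t3
        nlinarith
      linarith
  linarith [hall (n + 1)]

/-- The first exit of an orbit that leaves the right half-plane. -/
theorem exists_first_exit {w : ℝ} {N : ℕ} (hN : (orb τ δ w N).1 < 0) :
    ∃ n < N, (∀ i ≤ n, 0 ≤ (orb τ δ w i).1) ∧ (orb τ δ w (n + 1)).1 < 0 := by
  classical
  have hex : ∃ N, (orb τ δ w N).1 < 0 := ⟨N, hN⟩
  have h0 : Nat.find hex ≠ 0 := by
    intro h
    have := Nat.find_spec hex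
    simp [h, orb_zero] at this
  obtain ⟨n, hn⟩ := Nat.exists_eq_succ_of_ne_zero h0
  refine ⟨n, ?_, fun i hi => ?_, ?_⟩
  · have := Nat.find_min' hex hN
    omega
  · exact not_lt.mp (Nat.find_min hex (by omega))
  · have := Nat.find_spec hex
    rwa [hn] at this

/-- Signs of the Lucas sequence up to the exit time of an orbit. -/
theorem lucas_sign (hδ : 0 < δ) {w : ℝ} (hw : 0 ≤ w) {n : ℕ}
    (hn : ∀ i ≤ n, 0 ≤ (orb τ δ w i).1) (hexit : (orb τ δ w (n + 1)).1 < 0) :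
    lucas τ δ (n + 1) ≤ 0 ∧ ∀ i, 1 ≤ i → i ≤ n + 1 →
      (0 < lucas τ δ i ∧ 0 < lucasSum τ δ i) ∨ lucas τ δ i ≤ 0 := by
  have key : ∀ i, 1 ≤ i → i ≤ n + 1 →
      (0 < lucas τ δ i ∧ 0 < lucasSum τ δ i) ∨
        (lucas τ δ i ≤ 0 ∧ ((orb τ δ w i).1 ≤ (orb τ δ w (i - 1)).1)) := by
    intro i hi
    induction i, hi using Nat.le_induction with
    | base => intro _; left; simp [lucas, lucasSum]
    | succ i hi ih =>
      intro hin
      have hd : (orb τ δ w (i + 1)).1 - (orb τ δ w i).1 =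
          lucas τ δ (i + 1) * (w + 1) - lucas τ δ i * w := by
        rw [orb_fst, orb_fst, lucasSum_succ]; ring
      simp only [Nat.add_sub_cancel]
      rcases ih (by omega) with ⟨h1, h2⟩ | ⟨h1, h2⟩
      · rcases lt_or_ge 0 (lucas τ δ (i + 1)) with h | h
        · left; rw [lucasSum_succ]; exact ⟨h, by linarith⟩
        · right; exact ⟨h, by nlinarith [mul_nonneg h1.le hw]⟩
      · right
        obtain ⟨m, rfl⟩ : ∃ m, i = m + 1 := ⟨i - 1, by omega⟩
        have h3 := orb_fst_antitone_step hδ hw hn hexit (m := m) (by omega) (by simpa using h2)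
        refine ⟨?_, h3⟩
        -- With U_i ≤ 0 < U_{i+1} the increment `hd` would be positive, against unimodality.
        by_contra! hc
        nlinarith [mul_nonneg (neg_nonneg.2 h1) hw, mul_pos hc (by linarith : 0 < w + 1)]
  refine ⟨?_, fun i h1 h2 => (key i h1 h2).imp id fun h => h.1⟩
  rcases key (n + 1) (by omega) le_rfl with h | h
  · rw [orb_fst] at hexit
    nlinarith [mul_nonneg h.1.le hw]
  · exact h.1

/-! ### Comparison of edges that cross the y-axis leftwards. -/

/-- The segment from `A` to `B`, which crosses the `y`-axis leftwards, crosses it above `(0, c)`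
and ends on or to the right of the line `edgeForm c = 0`. -/
def PassesAbove (c : ℝ) (A B : ℝ × ℝ) : Prop :=
  edgeForm c B ≤ 0 ∧ 0 < A.1 * (B.2 - c) - B.1 * (A.2 - c)

/-- The segment from `A` to `B`, which crosses the `y`-axis leftwards, crosses it below `(0, c)`
and ends on or to the left of the line `edgeForm c = 0`. -/
def PassesBelow (c : ℝ) (A B : ℝ × ℝ) : Prop :=
  0 ≤ edgeForm c B ∧ A.1 * (B.2 - c) - B.1 * (A.2 - c) < 0

/-- The orbit of `(0, w)` stays in the closed right half-plane up to time `k`, and is in the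
closed left half-plane at time `k + 1`. -/
def CrossesAt (τ δ w : ℝ) (k : ℕ) : Prop :=
  (∀ i ≤ k, 0 ≤ (orb τ δ w i).1) ∧ (orb τ δ w (k + 1)).1 ≤ 0

/-- To the right of a leftward edge means above it, so A'B' crosses higher than AB. The point of AB
with the abscissa of B' lies between B and the crossing point, where `edgeForm c` is nonpositive,
and moving up does not increase `edgeForm c` because c + 1 ≤ 0. -/
theorem PassesAbove.mono {c : ℝ} (hc : c + 1 ≤ 0) {A B A' B' : ℝ × ℝ} (h : PassesAbove c A B)
    (hA : 0 ≤ A.1) (hB : B.1 ≤ 0) (hA' : 0 ≤ A'.1) (hB' : B'.1 ≤ 0) (hAB' : 0 < A'.1 - B'.1)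
    (tA : turn A B A' ≤ 0) (tB : turn A B B' ≤ 0) (hle : B.1 ≤ B'.1) :
    PassesAbove c A' B' := by
  obtain ⟨h1, h2⟩ := h
  have hD : 0 < A.1 - B.1 := by
    by_contra! h
    have e1 : A.1 = 0 := by linarith
    have e2 : B.1 = 0 := by linarith
    simp [e1, e2] at h2
  constructor
  · have e : (A.1 - B.1) * edgeForm c B' = (edgeForm c B * (A.1 - B'.1)
        + edgeForm c A * (B'.1 - B.1)) - (c + 1) * turn A B B' := by
      simp only [edgeForm, turn]; ring
    have t : 0 ≤ (c + 1) * turn A B B' := mul_nonneg_of_nonpos_of_nonpos hc tB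
    suffices hs : edgeForm c B * (A.1 - B'.1) + edgeForm c A * (B'.1 - B.1) ≤ 0 by
      exact nonpos_of_mul_nonpos_right (by rw [e]; linarith) hD
    rcases hB.lt_or_eq with hB0 | hB0
    · have e2 : (-B.1) * (edgeForm c B * (A.1 - B'.1) + edgeForm c A * (B'.1 - B.1)) =
          (-B'.1) * ((A.1 - B.1) * edgeForm c B)
          + (B'.1 - B.1) * ((c + 1) * (A.1 * (B.2 - c) - B.1 * (A.2 - c))) := by
        simp only [edgeForm]; ring
      have p1 : (-B'.1) * ((A.1 - B.1) * edgeForm c B) ≤ 0 :=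
        mul_nonpos_of_nonneg_of_nonpos (by linarith)
          (mul_nonpos_of_nonneg_of_nonpos hD.le h1)
      have p2 : (B'.1 - B.1) * ((c + 1) * (A.1 * (B.2 - c) - B.1 * (A.2 - c))) ≤ 0 :=
        mul_nonpos_of_nonneg_of_nonpos (by linarith) (mul_nonpos_of_nonpos_of_nonneg hc h2.le)
      exact nonpos_of_mul_nonpos_right (by rw [e2]; linarith) (by linarith : 0 < -B.1)
    · have : B'.1 = 0 := by linarith
      rw [hB0, this]
      simpa using mul_nonpos_of_nonpos_of_nonneg h1 hA
  · have e : (A.1 - B.1) * (A'.1 * (B'.2 - c) - B'.1 * (A'.2 - c)) =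
        (A'.1 - B'.1) * (A.1 * (B.2 - c) - B.1 * (A.2 - c))
        - (A'.1 * turn A B B' + (-B'.1) * turn A B A') := by
      simp only [turn]; ring
    have p1 := mul_pos hAB' h2
    have p2 := mul_nonpos_of_nonneg_of_nonpos hA' tB
    have p3 := mul_nonpos_of_nonneg_of_nonpos (neg_nonneg.2 hB') tA
    exact pos_of_mul_pos_right (by rw [e]; linarith) hD.le

theorem PassesBelow.mono (hδ : 0 < δ) {c : ℝ} (hc : c + 1 ≤ 0) {A A' B' : ℝ × ℝ}
    (h : PassesBelow c A (step τ δ A))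
    (hA : 0 ≤ A.1) (hB : (step τ δ A).1 ≤ 0) (hA' : 0 ≤ A'.1) (hB' : B'.1 ≤ 0)
    (hAB' : 0 < A'.1 - B'.1)
    (tA : 0 ≤ turn A (step τ δ A) A') (tB : 0 ≤ turn A (step τ δ A) B')
    (tC : 0 ≤ turn (step τ δ A) (step τ δ (step τ δ A)) B')
    (hle : B'.1 ≤ (step τ δ A).1) (hB2 : B'.2 ≤ 0) :
    PassesBelow c A' B' := by
  obtain ⟨h1, h2⟩ := h
  have hB2' : (step τ δ A).2 = -δ * A.1 := rfl
  have hB1' : (step τ δ A).1 = τ * A.1 + A.2 + 1 := rfl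
  have hC2 : (step τ δ (step τ δ A)).2 = -δ * (step τ δ A).1 := rfl
  have hC1 : (step τ δ (step τ δ A)).1 = τ * (step τ δ A).1 + (step τ δ A).2 + 1 := rfl
  set B := step τ δ A
  set C := step τ δ B
  have hD : 0 < A.1 - B.1 := by
    by_contra! h
    have e1 : A.1 = 0 := by linarith
    have e2 : B.1 = 0 := by linarith
    simp [e1, e2] at h2
  constructor
  · have e0 : edgeForm c B' = edgeForm c B + (c + 1) * (B'.2 - B.2) + c * (B'.1 - B.1) := by
      simp only [edgeForm]; ring
    have hx : 0 ≤ c * (B'.1 - B.1) := mul_nonneg_of_nonpos_of_nonpos (by linarith) (by linarith)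
    rcases le_or_gt B'.2 B.2 with hy | hy
    · have := mul_nonneg_of_nonpos_of_nonpos hc (sub_nonpos.2 hy)
      linarith
    -- When B' is higher than B, the next edge line BC is used. At height 0 it passes through the
    -- image of the crossing point of AB, where `edgeForm c` is positive; B' has height in (B.2, 0]
    -- and lies to the left of this line, and c < 0.
    · set η := B'.2 - B.2 with hη
      have hη0 : 0 < η := by linarith
      have hη1 : η ≤ δ * A.1 := by rw [hη]; linarith
      simp only [turn] at tC
      have i1 : δ * (A.1 - B.1) * (B'.1 - B.1) ≤ (C.1 - B.1) * η := by
        rw [hC2, hB2'] at tC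
        rw [hη, hB2']
        linarith
      -- the value of the affine form on the segment from `B` to the image of the crossing point
      have i2 : δ * (A.1 - B.1) * edgeForm c B' ≥
          (δ * A.1 - η) * ((A.1 - B.1) * edgeForm c B) / A.1
          + η * (c * (A.1 * (B.2 - c) - B.1 * (A.2 - c))) / A.1 := by
        have hA0 : 0 < A.1 := by
          rcases hA.lt_or_eq with h | h
          · exact h
          · rw [← h] at hη1; linarith
        have i3 : c * ((C.1 - B.1) * η) ≤ c * (δ * (A.1 - B.1) * (B'.1 - B.1)) :=
          mul_le_mul_of_nonpos_left i1 (by linarith)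
        have e3 : (δ * A.1 - η) * ((A.1 - B.1) * edgeForm c B) / A.1
          + η * (c * (A.1 * (B.2 - c) - B.1 * (A.2 - c))) / A.1 =
          δ * (A.1 - B.1) * (edgeForm c B + (c + 1) * η) + c * ((C.1 - B.1) * η) := by
          have hA2 : A.2 = B.1 - τ * A.1 - 1 := by linarith
          rw [hC1, hA2]
          simp only [edgeForm, hB2']
          field_simp
          ring
        rw [e3, e0]
        linarith
      have p1 : 0 ≤ (δ * A.1 - η) * ((A.1 - B.1) * edgeForm c B) / A.1 :=
        div_nonneg (mul_nonneg (by linarith) (mul_nonneg hD.le h1)) hA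
      have p2 : 0 ≤ η * (c * (A.1 * (B.2 - c) - B.1 * (A.2 - c))) / A.1 :=
        div_nonneg (mul_nonneg hη0.le
          (mul_nonneg_of_nonpos_of_nonpos (by linarith) h2.le)) hA
      exact nonneg_of_mul_nonneg_right (by linarith : 0 ≤ δ * (A.1 - B.1) * edgeForm c B')
        (mul_pos hδ hD)
  · have e : (A.1 - B.1) * (A'.1 * (B'.2 - c) - B'.1 * (A'.2 - c)) =
        (A'.1 - B'.1) * (A.1 * (B.2 - c) - B.1 * (A.2 - c))
        - (A'.1 * turn A B B' + (-B'.1) * turn A B A') := by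
      simp only [turn]; ring
    have p1 := mul_neg_of_pos_of_neg hAB' h2
    have p2 := mul_nonneg hA' tB
    have p3 := mul_nonneg (neg_nonneg.2 hB') tA
    by_contra! hcon
    have := mul_nonneg hD.le hcon
    linarith

/-! ### Dependence of the exit on the starting height. -/

theorem orb_fst_le_of_le {w w' : ℝ} (h : w ≤ w') {k : ℕ} (hk : lucas τ δ k ≤ 0) :
    (orb τ δ w' k).1 ≤ (orb τ δ w k).1 := by
  rw [orb_fst, orb_fst]
  linarith [mul_le_mul_of_nonpos_left h hk]

/-- Consequences of an exit at time `Q + 1` of the orbit of `(0, t)`. -/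
structure ExitsAt (τ δ t : ℝ) (Q : ℕ) : Prop where
  pos : 0 < δ
  start : 0 ≤ t
  stays : ∀ i ≤ Q, 0 ≤ (orb τ δ t i).1
  exit : (orb τ δ t (Q + 1)).1 < 0

namespace ExitsAt

variable {t : ℝ} {Q : ℕ}

/-- Up to index Q + 1 the i-th abscissa is either positive for every starting height w ≥ 0 or
nonincreasing in w; the signs of U_i obtained from the single orbit of (0, t) settle this for all w.
-/
theorem orb_nonneg_of_le (h : ExitsAt τ δ t Q) {w w' : ℝ} (hw : 0 ≤ w) (hww : w ≤ w') {i : ℕ}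
    (hi : i ≤ Q + 1) (hx : 0 ≤ (orb τ δ w' i).1) : 0 ≤ (orb τ δ w i).1 := by
  rcases Nat.eq_zero_or_pos i with rfl | hi0
  · simp [orb_zero]
  rcases (lucas_sign h.pos h.start h.stays h.exit).2 i hi0 hi with ⟨h1, h2⟩ | h1
  · rw [orb_fst]; positivity
  · exact hx.trans (orb_fst_le_of_le hww h1)

theorem lucas_nonpos (h : ExitsAt τ δ t Q) {w : ℝ} (hw : 0 ≤ w) {k : ℕ} (hk : k ≤ Q)
    (hx : (orb τ δ w (k + 1)).1 ≤ 0) : lucas τ δ (k + 1) ≤ 0 := by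
  rcases (lucas_sign h.pos h.start h.stays h.exit).2 (k + 1) (by omega) (by omega)
    with ⟨h1, h2⟩ | h1
  · rw [orb_fst] at hx
    nlinarith [mul_nonneg h1.le hw]
  · exact h1

theorem exists_exit (h : ExitsAt τ δ t Q) {w : ℝ} (hw : t ≤ w) :
    ∃ n ≤ Q, ExitsAt τ δ w n := by
  have h1 := orb_fst_le_of_le hw (lucas_sign h.pos h.start h.stays h.exit).1
  obtain ⟨n, hn, h2, h3⟩ := exists_first_exit (h1.trans_lt h.exit)
  exact ⟨n, by omega, h.pos, h.start.trans hw, h2, h3⟩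

/-- An orbit that returns to the `y`-axis before its exit does so below height `-1`. -/
theorem orb_of_eq_zero (h : ExitsAt τ δ t Q) {k : ℕ} (hk : k + 1 ≤ Q)
    (hx : (orb τ δ t (k + 1)).1 = 0) :
    0 < (orb τ δ t k).1 ∧ (orb τ δ t (k + 2)).1 ≤ 0 := by
  have h0 := h.stays k (by omega)
  have h1 := orb_fst_antitone_step h.pos h.start h.stays h.exit hk (by rw [hx]; exact h0)
  rw [hx] at h1
  refine ⟨h0.lt_of_ne fun he => ?_, h1⟩
  have h2 : (orb τ δ t (k + 2)).1 = 1 := by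
    rw [orb_succ, step, orb_succ_snd, hx, ← he]; simp
  linarith

theorem le_of_stays (h : ExitsAt τ δ t Q) {k : ℕ} (hk : ∀ i ≤ k, 0 ≤ (orb τ δ t i).1) :
    k ≤ Q := by
  by_contra! hc
  linarith [hk (Q + 1) hc, h.exit]

theorem crossing_strict (h : ExitsAt τ δ t Q) {w : ℝ} (hw : t ≤ w) {k : ℕ}
    (hk : CrossesAt τ δ w k) : 0 < (orb τ δ w k).1 - (orb τ δ w (k + 1)).1 := by
  obtain ⟨n, hn, hE⟩ := h.exists_exit hw
  have h0 := hk.1 k le_rfl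
  rcases hk.2.lt_or_eq with h1 | h1
  · linarith
  · have hkn : k + 1 ≤ n := hE.le_of_stays fun i hi => by
      rcases Nat.le_succ_iff.mp hi with h | rfl
      · exact hk.1 i h
      · rw [h1]
    have := (hE.orb_of_eq_zero hkn h1).1
    linarith

theorem exists_root {w w' : ℝ} (hww : w ≤ w') {i : ℕ} (h0 : 0 ≤ (orb τ δ w i).1)
    (h1 : (orb τ δ w' i).1 ≤ 0) : ∃ v ∈ Icc w w', (orb τ δ v i).1 = 0 := by
  have hc : ContinuousOn (fun v => (orb τ δ v i).1) (Icc w w') := by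
    simp only [orb_fst]; fun_prop
  exact intermediate_value_Icc' hww hc ⟨h1, h0⟩

theorem passesBelow_of_le (h : ExitsAt τ δ t Q) {c : ℝ} (hc : c + 1 ≤ 0) {w w' : ℝ}
    (hw : t ≤ w) (hww : w ≤ w') {k : ℕ} (hk : CrossesAt τ δ w k) (hk' : CrossesAt τ δ w' k)
    (hkQ : k ≤ Q) (hk1 : 1 ≤ k) (hp : PassesBelow c (orb τ δ w k) (orb τ δ w (k + 1))) :
    PassesBelow c (orb τ δ w' k) (orb τ δ w' (k + 1)) := by
  have hw0 := h.start.trans hw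
  have hδ := h.pos
  obtain ⟨m, rfl⟩ : ∃ m, k = m + 1 := ⟨k - 1, by omega⟩
  have t0 : ∀ n, 0 ≤ turn (orb τ δ w n) (orb τ δ w (n + 1)) (orb τ δ w' n) := fun n => by
    have := turn_orb (τ := τ) (δ := δ) w w' n 0
    rw [add_zero, turn_orb_start] at this
    rw [this]
    exact mul_nonneg (by positivity) (mul_nonneg (by linarith) (by linarith))
  have t1 : ∀ n, 0 ≤ turn (orb τ δ w n) (orb τ δ w (n + 1)) (orb τ δ w' (n + 1)) := fun n => by
    rw [turn_orb w w' n 1, turn_orb_next]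
    exact mul_nonneg (by positivity) (mul_nonneg hw0 (by linarith))
  have hstep := orb_succ (τ := τ) (δ := δ) w (m + 1)
  have tC := t0 (m + 1 + 1)
  rw [orb_succ w (m + 1 + 1), hstep] at tC
  have tA := t0 (m + 1)
  have tB := t1 (m + 1)
  rw [hstep] at tA tB hp
  refine PassesBelow.mono hδ hc hp (hk.1 _ le_rfl) (hstep ▸ hk.2)
    (hk'.1 _ le_rfl) hk'.2 (h.crossing_strict (hw.trans hww) hk') tA tB tC ?_ ?_
  · rw [← hstep]
    exact orb_fst_le_of_le hww (h.lucas_nonpos hw0 hkQ hk.2)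
  · rw [orb_succ_snd]
    nlinarith [hk'.1 (m + 1) le_rfl]

theorem passesAbove_of_le (h : ExitsAt τ δ t Q) {c : ℝ} (hc : c + 1 ≤ 0) {w w' : ℝ}
    (hw : t ≤ w) (hww : w ≤ w') {k : ℕ} (hk : CrossesAt τ δ w k) (hk' : CrossesAt τ δ w' k)
    (hkQ : k ≤ Q) (hp : PassesAbove c (orb τ δ w' k) (orb τ δ w' (k + 1))) :
    PassesAbove c (orb τ δ w k) (orb τ δ w (k + 1)) := by
  have hw0 := h.start.trans hw
  have hδ := h.pos
  have t0 : turn (orb τ δ w' k) (orb τ δ w' (k + 1)) (orb τ δ w k) ≤ 0 := by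
    have := turn_orb (τ := τ) (δ := δ) w' w k 0
    rw [add_zero, turn_orb_start] at this
    rw [this]
    exact mul_nonpos_of_nonneg_of_nonpos (by positivity)
      (mul_nonpos_of_nonneg_of_nonpos (by linarith) (by linarith))
  have t1 : turn (orb τ δ w' k) (orb τ δ w' (k + 1)) (orb τ δ w (k + 1)) ≤ 0 := by
    rw [turn_orb w' w k 1, turn_orb_next]
    exact mul_nonpos_of_nonneg_of_nonpos (by positivity)
      (mul_nonpos_of_nonneg_of_nonpos (by linarith) (by linarith))
  exact hp.mono hc (hk'.1 _ le_rfl) hk'.2 (hk.1 _ le_rfl) hk.2 (h.crossing_strict hw hk) t0 t1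
    (orb_fst_le_of_le hww (h.lucas_nonpos hw0 hkQ hk.2))

/-- Induction on Q - k: higher starting points exit no later, so larger w are reached by lowering
the crossing index one unit at a time. -/
theorem passesBelow (h : ExitsAt τ δ t Q) {c : ℝ} (hc : c + 1 ≤ 0)
    (hp : PassesBelow c (orb τ δ t Q) (orb τ δ t (Q + 1))) {w : ℝ} (hw : t ≤ w) {k : ℕ}
    (hk1 : 1 ≤ k) (hk : CrossesAt τ δ w k) :
    PassesBelow c (orb τ δ w k) (orb τ δ w (k + 1)) := by
  have hkQ : k ≤ Q := by
    obtain ⟨n, hn, hE⟩ := h.exists_exit hw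
    exact (hE.le_of_stays hk.1).trans hn
  obtain ⟨d, hd⟩ := Nat.exists_eq_add_of_le hkQ
  induction d generalizing w k with
  | zero =>
    rw [add_zero] at hd
    subst hd
    exact h.passesBelow_of_le hc le_rfl hw ⟨h.stays, h.exit.le⟩ hk le_rfl hk1 hp
  | succ d ih =>
    -- The orbit from height v has its iterate k + 1 on the axis, so it crosses at both indices k
    -- and k + 1, at the same point. The weak inequalities in `CrossesAt` exist for this case.
    obtain ⟨v, ⟨hv1, hv2⟩, hv⟩ := exists_root hw (h.stays (k + 1) (by omega)) hk.2
    have hv0 := h.start.trans hv1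
    have hst : ∀ i ≤ k, 0 ≤ (orb τ δ v i).1 := fun i hi =>
      h.orb_nonneg_of_le hv0 hv2 (by omega) (hk.1 i hi)
    have hst' : ∀ i ≤ k + 1, 0 ≤ (orb τ δ v i).1 := fun i hi => by
      rcases Nat.le_succ_iff.mp hi with h | rfl
      · exact hst i h
      · rw [hv]
    obtain ⟨n, hn, hE⟩ := h.exists_exit hv1
    obtain ⟨hpos, hneg⟩ := hE.orb_of_eq_zero (hE.le_of_stays hst') hv
    have hI := (ih hv1 (by omega) ⟨hst', hneg⟩ (by omega) (by omega)).2
    rw [hv, zero_mul, zero_sub, neg_lt_zero] at hI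
    have hlow : (orb τ δ v (k + 1)).2 - c < 0 := by
      by_contra! hcon
      linarith [mul_nonpos_of_nonpos_of_nonneg hneg hcon]
    refine h.passesBelow_of_le hc hv1 hv2 ⟨hst, hv.le⟩ hk hkQ hk1 ⟨?_, ?_⟩
    · simp only [edgeForm, hv]
      linarith [mul_nonneg_of_nonpos_of_nonpos hc hlow.le]
    · rw [hv]
      linarith [mul_neg_of_pos_of_neg hpos hlow]

/-- The mirror induction descends from s while the crossing index grows from q; control from below
by c' is needed at the transition heights. -/
theorem passesAbove (h : ExitsAt τ δ t Q) {c c' : ℝ} (hc : c + 1 ≤ 0) (hc' : c' + 1 ≤ 0)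
    (hp : PassesBelow c' (orb τ δ t Q) (orb τ δ t (Q + 1))) {s : ℝ} {q : ℕ} (hq1 : 1 ≤ q)
    (hts : t ≤ s) (hq : CrossesAt τ δ s q)
    (hps : PassesAbove c (orb τ δ s q) (orb τ δ s (q + 1))) {w : ℝ} (htw : t ≤ w)
    (hws : w ≤ s) {k : ℕ} (hqk : q ≤ k) (hk : CrossesAt τ δ w k) :
    PassesAbove c (orb τ δ w k) (orb τ δ w (k + 1)) := by
  have hkQ : k ≤ Q := by
    obtain ⟨n, hn, hE⟩ := h.exists_exit htw
    exact (hE.le_of_stays hk.1).trans hn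
  obtain ⟨d, hd⟩ := Nat.exists_eq_add_of_le hqk
  induction d generalizing s q with
  | zero =>
    rw [add_zero] at hd
    subst hd
    exact h.passesAbove_of_le hc htw hws hk hq hkQ hps
  | succ d ih =>
    obtain ⟨v, ⟨hv1, hv2⟩, hv⟩ := exists_root hws (hk.1 (q + 1) (by omega)) hq.2
    have htv := htw.trans hv1
    have hv0 := h.start.trans htv
    have hst : ∀ i ≤ q, 0 ≤ (orb τ δ v i).1 := fun i hi =>
      h.orb_nonneg_of_le hv0 hv2 (by omega) (hq.1 i hi)
    have hst' : ∀ i ≤ q + 1, 0 ≤ (orb τ δ v i).1 := fun i hi => by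
      rcases Nat.le_succ_iff.mp hi with h | rfl
      · exact hst i h
      · rw [hv]
    obtain ⟨n, hn, hE⟩ := h.exists_exit htv
    obtain ⟨hpos, hneg⟩ := hE.orb_of_eq_zero (hE.le_of_stays hst') hv
    have hA := (h.passesAbove_of_le hc htv hv2 ⟨hst, hv.le⟩ hq (by omega) hps).2
    have hB := (h.passesBelow hc' hp htv (by omega) ⟨hst', hneg⟩).2
    rw [hv, zero_mul, sub_zero] at hA
    rw [hv, zero_mul, zero_sub, neg_lt_zero] at hB
    have hhigh : 0 < (orb τ δ v (q + 1)).2 - c := pos_of_mul_pos_right hA hpos.le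
    -- If this iterate were on the axis too, the strict inequality in `PassesBelow` would read 0 <
    -- 0.
    have hneg' : (orb τ δ v (q + 2)).1 < 0 := by
      refine hneg.lt_of_ne fun he => ?_
      rw [show q + 1 + 1 = q + 2 from rfl, he, zero_mul] at hB
      exact lt_irrefl _ hB
    refine ih (by omega) htv ⟨hst', hneg⟩ ⟨?_, ?_⟩ hv1 (by omega) (by omega)
    · rw [orb_succ]
      simp only [edgeForm, step, hv]
      nlinarith
    · rw [hv, show q + 1 + 1 = q + 2 from rfl]
      nlinarith [mul_pos_of_neg_of_neg hneg' (neg_lt_zero.2 hhigh)]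

end ExitsAt

/-! ### Return of a point through the right half-plane. -/

/-- When H lies between B and the crossing point (0, y) of AB, this writes its form as a convex
combination of those at B and (0, y); the latter is (c + 1)(y - c). -/
theorem edgeForm_before_end {c l : ℝ} {A B H : ℝ × ℝ}
    (hH : H = ((1 - l) * A.1 + l * B.1, (1 - l) * A.2 + l * B.2)) :
    (-B.1) * ((A.1 - B.1) * edgeForm c H) = (-H.1) * ((A.1 - B.1) * edgeForm c B)
      + (H.1 - B.1) * ((c + 1) * (A.1 * (B.2 - c) - B.1 * (A.2 - c))) := by
  subst hH; simp only [edgeForm]; ring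

/-- When H lies between A and the crossing point (0, y), its image lies between B and (y + 1, 0),
where the form is c(y - c). -/
theorem edgeForm_after_end {c l : ℝ} {A H : ℝ × ℝ}
    (hH : H = ((1 - l) * A.1 + l * (step τ δ A).1, (1 - l) * A.2 + l * (step τ δ A).2)) :
    A.1 * ((A.1 - (step τ δ A).1) * edgeForm c (step τ δ H)) =
      H.1 * ((A.1 - (step τ δ A).1) * edgeForm c (step τ δ A))
      + (A.1 - H.1) * (c * (A.1 * ((step τ δ A).2 - c) - (step τ δ A).1 * (A.2 - c))) := by
  subst hH; simp only [edgeForm, step]; ring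

theorem fst_after_end (c : ℝ) {l : ℝ} {A H : ℝ × ℝ}
    (hH : H = ((1 - l) * A.1 + l * (step τ δ A).1, (1 - l) * A.2 + l * (step τ δ A).2)) :
    A.1 * ((A.1 - (step τ δ A).1) * (step τ δ H).1) =
      H.1 * ((A.1 - (step τ δ A).1) * (step τ δ A).1)
      + (A.1 - H.1) * ((A.1 * ((step τ δ A).2 - c) - (step τ δ A).1 * (A.2 - c))
        + (c + 1) * (A.1 - (step τ δ A).1)) := by
  subst hH; simp only [step]; ring

/-- The segments from `(0, w)` to `(w + 1, 0)` foliate the open right half of the first quadrant. -/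
theorem exists_segment {s t : ℝ} (ht : 0 ≤ t) (hts : t ≤ s) (hs : 0 < s) {W : ℝ × ℝ}
    (h1 : 0 < W.1) (h2 : 0 ≤ W.2) (hWt : t * (t + 1) ≤ (t + 1) * W.2 + t * W.1)
    (hWs : (s + 1) * W.2 + s * W.1 ≤ s * (s + 1)) :
    ∃ w ∈ Icc t s, ∃ l ∈ Icc (0 : ℝ) 1, W = ((1 - l) * 0 + l * (w + 1), (1 - l) * w + l * 0) := by
  have hX : W.1 - 1 ≤ s := by
    by_contra! hc
    nlinarith [mul_pos hs (by linarith : 0 < W.1 - 1 - s), mul_nonneg hs.le h2]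
  -- The lower bound W.1 - 1 keeps W.1/(w + 1) at most 1; at w = W.1 - 1 the function equals W.1 ·
  -- W.2 ≥ 0.
  obtain ⟨w, ⟨hw1, hw2⟩, hw⟩ : ∃ w ∈ Icc (max t (W.1 - 1)) s,
      (w + 1) * W.2 + w * W.1 - w * (w + 1) = 0 := by
    have hc : ContinuousOn (fun w => (w + 1) * W.2 + w * W.1 - w * (w + 1))
        (Icc (max t (W.1 - 1)) s) := by fun_prop
    refine intermediate_value_Icc' (max_le hts hX) hc ⟨by linarith, ?_⟩
    rcases max_choice t (W.1 - 1) with h | h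
    · simp only [h]; linarith
    · simp only [h]; nlinarith [mul_nonneg h1.le h2]
  have hw3 := (le_max_left _ _).trans hw1
  have hw4 := (le_max_right _ _).trans hw1
  have hw0 : 0 < w + 1 := by linarith
  refine ⟨w, ⟨hw3, hw2⟩, W.1 / (w + 1), ⟨by positivity, ?_⟩, ?_⟩
  · rw [div_le_one hw0]; linarith
  · ext
    · simp only; field_simp; ring
    · simp only; field_simp; linarith

/-- The excursion through the right half-plane of a point between two segments, whose exits are
controlled by those of the end points of the segments. -/
theorem exists_return {s t c c' : ℝ} {q Q : ℕ} (hq1 : 1 ≤ q) (hts : t ≤ s)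
    (hs : 0 < s) (hc : c + 1 ≤ 0) (hc' : c' + 1 ≤ 0) (hT : ExitsAt τ δ t Q) (hS : ExitsAt τ δ s q)
    (hpT : PassesBelow c' (orb τ δ t Q) (orb τ δ t (Q + 1)))
    (hpS : PassesAbove c (orb τ δ s q) (orb τ δ s (q + 1))) {W : ℝ × ℝ}
    (h1 : 0 < W.1) (h2 : 0 ≤ W.2) (hWt : t * (t + 1) ≤ (t + 1) * W.2 + t * W.1)
    (hWs : (s + 1) * W.2 + s * W.1 ≤ s * (s + 1)) :
    ∃ j, q ≤ j ∧ j ≤ Q + 1 ∧ (∀ i < j, 0 ≤ ((step τ δ)^[i] W).1) ∧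
      ((step τ δ)^[j] W).1 < 0 ∧ edgeForm c ((step τ δ)^[j] W) ≤ 0 ∧
      0 ≤ edgeForm c' ((step τ δ)^[j] W) := by
  obtain ⟨w, ⟨hw1, hw2⟩, l, ⟨hl0, hl1⟩, hW⟩ := exists_segment hT.start hts hs h1 h2 hWt hWs
  obtain ⟨k, hkQ, hE⟩ := hT.exists_exit hw1
  have hqQ : q ≤ Q := by
    obtain ⟨n, hn, hE'⟩ := hT.exists_exit hts
    exact (hE'.le_of_stays hS.stays).trans hn
  have hqk : q ≤ k := hE.le_of_stays fun i hi =>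
    hT.orb_nonneg_of_le hE.start hw2 (by omega) (hS.stays i hi)
  have hcr : CrossesAt τ δ w k := ⟨hE.stays, hE.exit.le⟩
  have hB := hT.passesBelow hc' hpT hw1 (by omega) hcr
  have hA := hT.passesAbove hc hc' hpT hq1 hts ⟨hS.stays, hS.exit.le⟩ hpS hw1 hw2 hqk hcr
  have hi : ∀ i, (step τ δ)^[i] W = ((1 - l) * (orb τ δ w i).1 + l * (orb τ δ w (i + 1)).1,
      (1 - l) * (orb τ δ w i).2 + l * (orb τ δ w (i + 1)).2) := fun i => by
    have := step_iterate_combo (τ := τ) (δ := δ) i (0, w) (w + 1, 0) (a := 1 - l) (b := l)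
      (by ring)
    rw [hW, this, orb, orb, Function.iterate_succ_apply,
      show step τ δ (0, w) = (w + 1, 0) by simp [step]]
  have hpos : ∀ i < k, 0 ≤ ((step τ δ)^[i] W).1 := fun i hik => by
    rw [hi]
    exact add_nonneg (mul_nonneg (by linarith) (hE.stays i hik.le))
      (mul_nonneg hl0 (hE.stays (i + 1) hik))
  have hH := hi k
  have hG : (step τ δ)^[k + 1] W = step τ δ ((step τ δ)^[k] W) := Function.iterate_succ_apply' _ _ _
  have hst := orb_succ (τ := τ) (δ := δ) w k
  have hx := hE.stays k le_rfl
  have hx' := hE.exit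
  obtain ⟨hA1, hA2⟩ := hA
  obtain ⟨hB1, hB2⟩ := hB
  set A := orb τ δ w k
  set H := (step τ δ)^[k] W
  rw [hst] at hH hA1 hA2 hB1 hB2 hx'
  have hD : 0 < A.1 - (step τ δ A).1 := by linarith
  rcases lt_or_ge H.1 0 with hH0 | hH0
  · refine ⟨k, hqk, by omega, hpos, hH0, ?_, ?_⟩
    all_goals
      have hlt : 0 ≤ H.1 - (step τ δ A).1 := by
        have : H.1 - (step τ δ A).1 = (1 - l) * (A.1 - (step τ δ A).1) := by rw [hH]; ring
        rw [this]; exact mul_nonneg (by linarith) hD.le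
    · have e := edgeForm_before_end (c := c) hH
      have p1 := mul_nonpos_of_nonneg_of_nonpos (neg_nonneg.2 hH0.le)
        (mul_nonpos_of_nonneg_of_nonpos hD.le hA1)
      have p2 := mul_nonpos_of_nonneg_of_nonpos hlt (mul_nonpos_of_nonpos_of_nonneg hc hA2.le)
      exact nonpos_of_mul_nonpos_right (nonpos_of_mul_nonpos_right
        (by rw [e]; linarith) (neg_pos.2 hx')) hD
    · have e := edgeForm_before_end (c := c') hH
      have p1 := mul_nonneg (neg_nonneg.2 hH0.le) (mul_nonneg hD.le hB1)
      have p2 := mul_nonneg hlt (mul_nonneg_of_nonpos_of_nonpos hc' hB2.le)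
      exact nonneg_of_mul_nonneg_right (nonneg_of_mul_nonneg_right
        (by rw [e]; linarith) (neg_pos.2 hx')) hD
  · have hstay : ∀ i < k + 1, 0 ≤ ((step τ δ)^[i] W).1 := fun i hi => by
      rcases Nat.lt_succ_iff_lt_or_eq.mp hi with h | rfl
      · exact hpos i h
      · exact hH0
    -- W is still in the closed right half-plane at time k, so it exits one step later; this is the
    -- source of the extra 1 in `qmax`.
    refine ⟨k + 1, by omega, by omega, hstay, ?_⟩
    rw [hG]
    rcases hl0.eq_or_lt with hl | hl
    · have : H = A := by rw [hH, ← hl]; ext <;> simp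
      rw [this]
      exact ⟨hx', hA1, hB1⟩
    · have hAH : 0 < A.1 - H.1 := by
        have : A.1 - H.1 = l * (A.1 - (step τ δ A).1) := by rw [hH]; ring
        rw [this]; exact mul_pos hl hD
      have hA0 : 0 < A.1 := by linarith
      refine ⟨?_, ?_, ?_⟩
      · have e := fst_after_end c' hH
        have p1 := mul_nonpos_of_nonneg_of_nonpos hH0
          (mul_nonpos_of_nonneg_of_nonpos hD.le hx'.le)
        have p2 := mul_neg_of_pos_of_neg hAH (add_neg_of_neg_of_nonpos hB2
          (mul_nonpos_of_nonpos_of_nonneg hc' hD.le))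
        by_contra! hcon
        have := mul_nonneg hA0.le (mul_nonneg hD.le hcon)
        linarith
      · have e := edgeForm_after_end (c := c) hH
        have p1 := mul_nonpos_of_nonneg_of_nonpos hH0
          (mul_nonpos_of_nonneg_of_nonpos hD.le hA1)
        have p2 := mul_nonpos_of_nonneg_of_nonpos hAH.le
          (mul_nonpos_of_nonpos_of_nonneg (by linarith : c ≤ 0) hA2.le)
        exact nonpos_of_mul_nonpos_right (nonpos_of_mul_nonpos_right
          (by rw [e]; linarith) hA0) hD
      · have e := edgeForm_after_end (c := c') hH
        have p1 := mul_nonneg hH0 (mul_nonneg hD.le hB1)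
        have p2 := mul_nonneg hAH.le
          (mul_nonneg_of_nonpos_of_nonpos (by linarith : c' ≤ 0) hB2.le)
        exact nonneg_of_mul_nonneg_right (nonneg_of_mul_nonneg_right
          (by rw [e]; linarith) hA0) hD

/-! ### Intercepts, landing heights and the passage through the left half-plane. -/

/-- The height at which the `i`-th preimage of the `y`-axis under `step` meets the `y`-axis. -/
noncomputable def intercept (τ δ : ℝ) (i : ℕ) : ℝ := -lucasSum τ δ i / lucas τ δ i

/-- The height at which `(0, intercept τ δ i)` returns to the `y`-axis after `i` steps. -/
noncomputable def landing (τ δ : ℝ) (i : ℕ) : ℝ := (orb τ δ (intercept τ δ i) i).2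

/-- Cassini's identity; its positive right-hand side makes the landing heights strictly increasing.
-/
theorem lucas_sq_sub (k : ℕ) :
    lucas τ δ (k + 1) ^ 2 - lucas τ δ k * lucas τ δ (k + 2) = δ ^ k := by
  induction k with
  | zero => simp [lucas]
  | succ n ih =>
    have h : lucas τ δ (n + 1 + 2) = τ * lucas τ δ (n + 2) - δ * lucas τ δ (n + 1) := rfl
    have h' : lucas τ δ (n + 2) = τ * lucas τ δ (n + 1) - δ * lucas τ δ n := rfl
    rw [pow_succ δ, ← ih, h, show n + 1 + 1 = n + 2 from rfl]
    linear_combination (lucas τ δ (n + 2) ) * h'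

theorem intercept_one : intercept τ δ 1 = -1 := by simp [intercept, lucas, lucasSum]

theorem landing_one : landing τ δ 1 = 0 := by simp [landing, orb_one]

theorem turn_edge (c : ℝ) (z : ℝ × ℝ) : turn (0, c) (c + 1, 0) z = edgeForm c z := by
  simp only [turn, edgeForm]; ring

theorem edgeForm_nonpos_of_le {r s : ℝ} (hr : 0 < r) (hrs : r ≤ s) {W : ℝ × ℝ}
    (h2 : 0 ≤ W.2) (h : edgeForm r W ≤ 0) : edgeForm s W ≤ 0 := by
  simp only [edgeForm] at h ⊢
  have hX : W.1 ≤ r + 1 := by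
    by_contra! hc
    nlinarith [mul_pos hr (sub_pos.2 hc), mul_nonneg hr.le h2]
  have hX' : W.1 ≤ (s + 1) * (r + 1) := by nlinarith
  -- The lines of the edges r and s meet at abscissa (s + 1)(r + 1) when r ≠ s, which no point below
  -- the r-edge with nonnegative ordinate passes.
  have e : (r + 1) * ((s + 1) * W.2 + s * W.1 - s * (s + 1)) =
      (s + 1) * ((r + 1) * W.2 + r * W.1 - r * (r + 1))
        + (s - r) * (W.1 - (s + 1) * (r + 1)) := by ring
  have p1 := mul_nonpos_of_nonneg_of_nonpos (by linarith : 0 ≤ s + 1) h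
  have p2 := mul_nonpos_of_nonneg_of_nonpos (sub_nonneg.2 hrs) (sub_nonpos.2 hX')
  exact nonpos_of_mul_nonpos_right (by rw [e]; linarith) (by linarith : 0 < r + 1)

theorem edgeForm_nonneg_of_le {r t : ℝ} (ht : 0 ≤ t) (htr : t ≤ r) {W : ℝ × ℝ}
    (h2 : 0 ≤ W.2) (h : 0 ≤ edgeForm r W) : 0 ≤ edgeForm t W := by
  rcases (ht.trans htr).eq_or_lt with hr | hr
  · rwa [show t = r by linarith]
  simp only [edgeForm] at h ⊢
  have e : (r * (r + 1)) * ((t + 1) * W.2 + t * W.1 - t * (t + 1)) =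
      t * (r + 1) * ((r + 1) * W.2 + r * W.1 - r * (r + 1))
        + (r - t) * ((r + 1) * W.2) + t * (r + 1) * r * (r - t) := by ring
  have p0 : 0 ≤ t * (r + 1) := by positivity
  have p1 := mul_nonneg p0 h
  have p2 := mul_nonneg (sub_nonneg.2 htr) (mul_nonneg (by linarith : 0 ≤ r + 1) h2)
  have p3 := mul_nonneg (mul_nonneg p0 hr.le) (sub_nonneg.2 htr)
  exact nonneg_of_mul_nonneg_right (by rw [e]; linarith) (by positivity : 0 < r * (r + 1))

/-- The positivity of the Lucas sequence up to index `M`. -/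
def LucasPos (τ δ : ℝ) (M : ℕ) : Prop := ∀ i, 1 ≤ i → i ≤ M → 0 < lucas τ δ i

namespace LucasPos

variable {M : ℕ}

theorem sum_pos (h : LucasPos τ δ M) {i : ℕ} (h1 : 1 ≤ i) (hM : i ≤ M) :
    0 < lucasSum τ δ i :=
  Finset.sum_pos (fun j hj => h _ (by omega) (by have := Finset.mem_range.mp hj; omega))
    ⟨0, Finset.mem_range.mpr h1⟩

theorem lucasSum_eq (h : LucasPos τ δ M) {i : ℕ} (h1 : 1 ≤ i) (hM : i ≤ M) :
    lucasSum τ δ i = -(lucas τ δ i * intercept τ δ i) := by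
  have := (h i h1 hM).ne'
  rw [intercept]; field_simp

theorem orb_intercept (h : LucasPos τ δ M) {i : ℕ} (h1 : 1 ≤ i) (hM : i ≤ M) :
    orb τ δ (intercept τ δ i) i = (0, landing τ δ i) := by
  ext
  · rw [orb_fst, h.lucasSum_eq h1 hM]; ring
  · rfl

theorem orb_fst_eq (h : LucasPos τ δ M) {i : ℕ} (h1 : 1 ≤ i) (hM : i ≤ M) (w : ℝ) :
    (orb τ δ w i).1 = lucas τ δ i * (w - intercept τ δ i) := by
  rw [orb_fst, h.lucasSum_eq h1 hM]; ring

theorem orb_intercept_succ (h : LucasPos τ δ M) {i : ℕ} (h1 : 1 ≤ i) (hM : i ≤ M) :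
    orb τ δ (intercept τ δ i) (i + 1) = (landing τ δ i + 1, 0) := by
  rw [orb_succ, h.orb_intercept h1 hM]; simp [step]

theorem landing_add_one (h : LucasPos τ δ M) {i : ℕ} (h1 : 1 ≤ i) (hM : i + 1 ≤ M) :
    landing τ δ i + 1 =
      (intercept τ δ i - intercept τ δ (i + 1)) * lucas τ δ (i + 1) := by
  have e1 := congrArg Prod.fst (h.orb_intercept_succ h1 (by omega))
  rw [h.orb_fst_eq (by omega) hM] at e1
  simp only at e1
  linarith

theorem landing_succ (h : LucasPos τ δ M) {i : ℕ} (h1 : 1 ≤ i) (hM : i + 1 ≤ M) :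
    landing τ δ (i + 1) =
      (intercept τ δ i - intercept τ δ (i + 1)) * (δ * lucas τ δ i) := by
  rw [landing, orb_succ_snd, h.orb_fst_eq h1 (by omega)]
  ring

theorem landing_mono_step (h : LucasPos τ δ M) (hδ : 0 < δ) {i : ℕ} (h1 : 1 ≤ i)
    (hM : i + 1 ≤ M) : 0 ≤ landing τ δ i ∧ intercept τ δ (i + 1) < intercept τ δ i ∧
      landing τ δ i < landing τ δ (i + 1) := by
  have lt_of_nonneg : ∀ i, 1 ≤ i → i + 1 ≤ M → 0 ≤ landing τ δ i →
      intercept τ δ (i + 1) < intercept τ δ i ∧ 0 < landing τ δ (i + 1) := by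
    intro i h1 hM h0
    have e := h.landing_add_one h1 hM
    have hc : 0 < intercept τ δ i - intercept τ δ (i + 1) :=
      pos_of_mul_pos_left (by rw [← e]; linarith) (h (i + 1) (by omega) hM).le
    refine ⟨by linarith, ?_⟩
    rw [h.landing_succ h1 hM]
    exact mul_pos hc (mul_pos hδ (h i h1 (by omega)))
  induction i, h1 using Nat.le_induction with
  | base =>
    have := lt_of_nonneg 1 le_rfl hM landing_one.ge
    exact ⟨landing_one.ge, this.1, by rw [landing_one]; exact this.2⟩
  | succ i h1 ih =>
    obtain ⟨a0, a1, a2⟩ := ih (by omega)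
    have h0 : 0 ≤ landing τ δ (i + 1) := a0.trans a2.le
    obtain ⟨b1, b2⟩ := lt_of_nonneg (i + 1) (by omega) hM h0
    refine ⟨h0, b1, ?_⟩
    have e1 := h.landing_add_one h1 (by omega)
    have e2 := h.landing_succ h1 (by omega)
    have e3 := h.landing_add_one (i := i + 1) (by omega) hM
    have e4 := h.landing_succ (i := i + 1) (by omega) hM
    have q := lucas_sq_sub (τ := τ) (δ := δ) i
    have p0 := h i h1 (by omega)
    have p1 := h (i + 1) (by omega) (by omega)
    have p2 := h (i + 1 + 1) (by omega) hM
    rw [show i + 2 = i + 1 + 1 from rfl] at q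
    have r1 : landing τ δ (i + 1) * lucas τ δ (i + 1) =
        (landing τ δ i + 1) * (δ * lucas τ δ i) := by rw [e2, e1]; ring
    have r2 : landing τ δ (i + 1 + 1) * lucas τ δ (i + 1 + 1) =
        (landing τ δ (i + 1) + 1) * (δ * lucas τ δ (i + 1)) := by rw [e4, e3]; ring
    have r3 : (landing τ δ (i + 1 + 1) - landing τ δ (i + 1)) *
        (lucas τ δ (i + 1) * lucas τ δ (i + 1 + 1)) =
        (landing τ δ (i + 1) + 1) * δ * δ ^ i
          + (landing τ δ (i + 1) - landing τ δ i) *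
            (δ * (lucas τ δ i * lucas τ δ (i + 1 + 1))) := by
      rw [← q]
      linear_combination lucas τ δ (i + 1) * r2 - lucas τ δ (i + 1 + 1) * r1
    have r4 : 0 < (landing τ δ (i + 1) + 1) * δ * δ ^ i := by positivity
    have r5 : 0 ≤ (landing τ δ (i + 1) - landing τ δ i) *
        (δ * (lucas τ δ i * lucas τ δ (i + 1 + 1))) :=
      mul_nonneg (by linarith) (by positivity)
    have := pos_of_mul_pos_left (by rw [r3]; linarith) (mul_pos p1 p2).le
    linarith

theorem landing_nonneg (h : LucasPos τ δ M) (hδ : 0 < δ) {i : ℕ} (h1 : 1 ≤ i) (hM : i ≤ M) :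
    0 ≤ landing τ δ i := by
  rcases Nat.eq_or_lt_of_le h1 with rfl | h2
  · exact landing_one.ge
  · obtain ⟨j, rfl⟩ : ∃ j, i = j + 1 := ⟨i - 1, by omega⟩
    have := h.landing_mono_step hδ (i := j) (by omega) hM
    linarith

theorem intercept_lt (h : LucasPos τ δ M) (hδ : 0 < δ) {i j : ℕ} (h1 : 1 ≤ i) (hij : i < j)
    (hM : j ≤ M) : intercept τ δ j < intercept τ δ i := by
  induction j, hij using Nat.le_induction with
  | base => exact (h.landing_mono_step hδ h1 hM).2.1
  | succ j hj ih =>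
    exact (h.landing_mono_step hδ (by omega) hM).2.1.trans (ih (by omega))

theorem landing_lt (h : LucasPos τ δ M) (hδ : 0 < δ) {i j : ℕ} (h1 : 1 ≤ i) (hij : i < j)
    (hM : j ≤ M) : landing τ δ i < landing τ δ j := by
  induction j, hij using Nat.le_induction with
  | base => exact (h.landing_mono_step hδ h1 hM).2.2
  | succ j hj ih =>
    exact (ih (by omega)).trans (h.landing_mono_step hδ (by omega) hM).2.2

theorem intercept_le (h : LucasPos τ δ M) (hδ : 0 < δ) {i j : ℕ} (h1 : 1 ≤ i) (hij : i ≤ j)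
    (hM : j ≤ M) : intercept τ δ j ≤ intercept τ δ i := by
  rcases hij.eq_or_lt with rfl | hij
  · exact le_rfl
  · exact (h.intercept_lt hδ h1 hij hM).le

theorem landing_le (h : LucasPos τ δ M) (hδ : 0 < δ) {i j : ℕ} (h1 : 1 ≤ i) (hij : i ≤ j)
    (hM : j ≤ M) : landing τ δ i ≤ landing τ δ j := by
  rcases hij.eq_or_lt with rfl | hij
  · exact le_rfl
  · exact (h.landing_lt hδ h1 hij hM).le

theorem intercept_le_neg_one (h : LucasPos τ δ M) (hδ : 0 < δ) {i : ℕ} (h1 : 1 ≤ i)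
    (hM : i ≤ M) : intercept τ δ i ≤ -1 :=
  (h.intercept_le hδ le_rfl h1 hM).trans_eq intercept_one

theorem intercept_lt_neg_one (h : LucasPos τ δ M) (hδ : 0 < δ) {i : ℕ} (h1 : 1 < i)
    (hM : i ≤ M) : intercept τ δ i < -1 :=
  (h.intercept_lt hδ le_rfl h1 hM).trans_eq intercept_one

theorem iterate_edge (h : LucasPos τ δ M) {i : ℕ} (h1 : 1 ≤ i) (hM : i ≤ M) :
    (step τ δ)^[i] (intercept τ δ i + 1, 0) = (landing τ δ i + 1, 0) := by
  rw [← h.orb_intercept_succ h1 hM, orb, Function.iterate_succ_apply]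
  simp [step]

theorem iterate_edge_succ (h : LucasPos τ δ M) {i : ℕ} (hM : i + 1 ≤ M) :
    (step τ δ)^[i] (intercept τ δ (i + 1) + 1, 0) = (0, landing τ δ (i + 1)) := by
  rw [← h.orb_intercept (by omega) hM, orb, Function.iterate_succ_apply]
  simp [step]

theorem edgeForm_iterate (h : LucasPos τ δ M) {i : ℕ} (h1 : 1 ≤ i) (hM : i ≤ M) (Z : ℝ × ℝ) :
    edgeForm (landing τ δ i) ((step τ δ)^[i] Z) = δ ^ i * edgeForm (intercept τ δ i) Z := by
  rw [← turn_edge, ← turn_edge, ← turn_iterate, h.iterate_edge h1 hM]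
  congr 1
  exact (h.orb_intercept h1 hM).symm

/-- The excursion through the left half-plane of a point of the third quadrant between two edges:
the time it takes, and the location of the first point on the right of the `y`-axis. -/
theorem exists_departure (h : LucasPos τ δ M) (hδ : 0 < δ) {m : ℕ} (hm : 1 ≤ m) (hmM : m < M)
    {Z : ℝ × ℝ} (hX : Z.1 < 0) (hY : Z.2 ≤ 0) (hS : edgeForm (intercept τ δ M) Z ≤ 0)
    (hT : 0 ≤ edgeForm (intercept τ δ m) Z) :
    ∃ p, m ≤ p ∧ p ≤ M ∧ (∀ i < p, ((step τ δ)^[i] Z).1 ≤ 0) ∧ 0 < ((step τ δ)^[p] Z).1 ∧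
      0 ≤ ((step τ δ)^[p] Z).2 ∧ edgeForm (landing τ δ M) ((step τ δ)^[p] Z) ≤ 0 ∧
      0 ≤ edgeForm (landing τ δ m) ((step τ δ)^[p] Z) := by
  classical
  have hMpos : 0 < ((step τ δ)^[M] Z).1 := by
    have hc := h.intercept_lt_neg_one hδ (by omega : 1 < M) le_rfl
    have hs := h.landing_nonneg hδ (by omega : 1 ≤ M) le_rfl
    have hK := h.sum_pos (by omega : 1 ≤ M) le_rfl
    have e1 := congrArg Prod.fst (h.iterate_edge (by omega : 1 ≤ M) le_rfl)
    have e2 := h.lucasSum_eq (by omega : 1 ≤ M) le_rfl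
    rw [step_iterate_fst] at e1 ⊢
    simp only [mul_zero, add_zero] at e1
    set c := intercept τ δ M
    have e : c * (c + 1) * (lucas τ δ (M + 1) * Z.1 + lucas τ δ M * Z.2 + lucasSum τ δ M) =
        c * Z.1 * (landing τ δ M + 1) - lucasSum τ δ M * edgeForm c Z := by
      rw [← e1]
      simp only [edgeForm]
      linear_combination (c + 1) * Z.2 * e2
    have p1 : 0 < c * Z.1 * (landing τ δ M + 1) :=
      mul_pos (mul_pos_of_neg_of_neg (by linarith) hX) (by linarith)
    have p2 := mul_nonpos_of_nonneg_of_nonpos hK.le hS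
    have p3 : 0 < c * (c + 1) := mul_pos_of_neg_of_neg (by linarith) (by linarith)
    exact pos_of_mul_pos_right (by rw [e]; linarith) p3.le
  have hlow : ∀ i < m, ((step τ δ)^[i] Z).1 ≤ 0 := by
    intro i him
    rcases Nat.eq_zero_or_pos i with rfl | hi
    · exact hX.le
    have hc := h.intercept_lt_neg_one hδ (by omega : 1 < m) hmM.le
    have hK := h.sum_pos hi (by omega)
    have e1 := h.lucasSum_eq hi (by omega)
    have e2 := h.lucasSum_eq (by omega : 1 ≤ i + 1) (by omega)
    rw [lucasSum_succ] at e2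
    have c1 := h.intercept_le hδ hi him.le hmM.le
    have c2 := h.intercept_le hδ (by omega : 1 ≤ i + 1) him hmM.le
    have b1 := h i hi (by omega)
    have b2 := h (i + 1) (by omega) (by omega)
    rw [step_iterate_fst]
    set c := intercept τ δ m
    have e : c * (c + 1) * (lucas τ δ (i + 1) * Z.1 + lucas τ δ i * Z.2 + lucasSum τ δ i) =
        c * Z.1 * (lucas τ δ (i + 1) * (c - intercept τ δ (i + 1)))
          + (c + 1) * Z.2 * (lucas τ δ i * (c - intercept τ δ i))
          - lucasSum τ δ i * edgeForm c Z := by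
      -- The identity is an expansion in barycentric coordinates for (0, c), (c + 1, 0) and the
      -- origin. The i-th abscissa is nonpositive at the first two and positive at the origin, whose
      -- weight is nonpositive by `hT`.
      simp only [edgeForm]
      linear_combination c * Z.1 * e2 + (c + 1) * Z.2 * e1
    have p1 := mul_nonpos_of_nonneg_of_nonpos
      (mul_nonneg_of_nonpos_of_nonpos (by linarith : c ≤ 0) hX.le)
      (mul_nonpos_of_nonneg_of_nonpos b2.le (sub_nonpos.2 c2))
    have p2 := mul_nonpos_of_nonneg_of_nonpos
      (mul_nonneg_of_nonpos_of_nonpos (by linarith : c + 1 ≤ 0) hY)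
      (mul_nonpos_of_nonneg_of_nonpos b1.le (sub_nonpos.2 c1))
    have p3 := mul_nonneg hK.le hT
    have p4 : 0 < c * (c + 1) := mul_pos_of_neg_of_neg (by linarith) (by linarith)
    exact nonpos_of_mul_nonpos_right (by rw [e]; linarith) p4
  have hex : ∃ p, 0 < ((step τ δ)^[p] Z).1 := ⟨M, hMpos⟩
  obtain ⟨p, hp, hpos, hpre⟩ : ∃ p, p ≤ M ∧ 0 < ((step τ δ)^[p] Z).1 ∧
      ∀ i < p, ((step τ δ)^[i] Z).1 ≤ 0 :=
    ⟨Nat.find hex, Nat.find_min' hex hMpos, Nat.find_spec hex,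
      fun i hi => not_lt.mp (Nat.find_min hex hi)⟩
  have hmp : m ≤ p := by
    by_contra! hc
    exact absurd (hlow p hc) (not_le.mpr hpos)
  have hp1 : 1 ≤ p := hm.trans hmp
  have hy : 0 ≤ ((step τ δ)^[p] Z).2 := by
    obtain ⟨n, rfl⟩ : ∃ n, p = n + 1 := ⟨p - 1, by omega⟩
    rw [step_iterate_succ_snd]
    nlinarith [hpre n (by omega)]
  refine ⟨p, hmp, hp, hpre, hpos, hy, ?_, ?_⟩
  · rcases hp.eq_or_lt with rfl | hpM
    · rw [h.edgeForm_iterate hp1 le_rfl]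
      exact mul_nonpos_of_nonneg_of_nonpos (by positivity) hS
    · have hc := h.intercept_lt hδ hp1 (Nat.lt_succ_self p) hpM
      have hs := h.landing_lt hδ hp1 (Nat.lt_succ_self p) hpM
      have hs0 := h.landing_nonneg hδ hp1 hp
      have e := turn_iterate (τ := τ) (δ := δ) p (intercept τ δ (p + 1) + 1, 0)
        (intercept τ δ p + 1, 0) Z
      rw [h.iterate_edge hp1 hp, h.iterate_edge_succ hpM] at e
      -- Z lies below the x-axis; `step^p` sends two points of that axis to (0, r_{p+1}) and (r_p +
      -- 1, 0), so the image of Z is below the line joining them.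
      have e' : turn (intercept τ δ (p + 1) + 1, 0) (intercept τ δ p + 1, 0) Z ≤ 0 := by
        simp only [turn]; nlinarith
      have e'' := mul_nonpos_of_nonneg_of_nonpos (pow_nonneg hδ.le p) e'
      rw [← e] at e''
      refine edgeForm_nonpos_of_le (hs0.trans_lt hs) (h.landing_le hδ (by omega) hpM le_rfl)
        hy ?_
      simp only [turn, edgeForm] at e'' ⊢
      set r := landing τ δ p
      set s := landing τ δ (p + 1)
      set W := (step τ δ)^[p] Z
      have e3 : (r + 1) * ((s + 1) * W.2 + s * W.1 - s * (s + 1)) =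
          (s + 1) * ((r + 1 - 0) * (W.2 - s) - (0 - s) * (W.1 - 0))
            - s * W.1 * (s - r) := by ring
      have p1 := mul_nonpos_of_nonneg_of_nonpos (by linarith : 0 ≤ s + 1) e''
      have p2 : 0 ≤ s * W.1 * (s - r) :=
        mul_nonneg (mul_nonneg (by linarith) hpos.le) (by linarith)
      exact nonpos_of_mul_nonpos_right (by rw [e3]; linarith) (by linarith : 0 < r + 1)
  · rcases hmp.eq_or_lt with rfl | hmp
    · rw [h.edgeForm_iterate hp1 hp]
      exact mul_nonneg (by positivity) hT
    · obtain ⟨n, rfl⟩ : ∃ n, p = n + 1 := ⟨p - 1, by omega⟩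
      have hn : 1 ≤ n := by omega
      have hc := h.intercept_lt hδ hn (Nat.lt_succ_self n) hp
      have hs := h.landing_lt hδ hn (Nat.lt_succ_self n) hp
      have hs0 := h.landing_nonneg hδ hn (by omega)
      have e := turn_iterate (τ := τ) (δ := δ) (n + 1) (0, intercept τ δ (n + 1))
        (0, intercept τ δ n) Z
      have o1 := h.orb_intercept hp1 hp
      have o2 := h.orb_intercept_succ hn (by omega)
      rw [orb] at o1 o2
      rw [o1, o2] at e
      -- Likewise Z lies left of the y-axis, whose image under n + 1 steps passes through (0,
      -- r_{n+1}) and (r_n + 1, 0).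
      have e' : 0 ≤ turn (0, intercept τ δ (n + 1)) (0, intercept τ δ n) Z := by
        simp only [turn]; nlinarith
      have e'' := mul_nonneg (pow_nonneg hδ.le (n + 1)) e'
      rw [← e] at e''
      refine edgeForm_nonneg_of_le (h.landing_nonneg hδ hm (by omega))
        (h.landing_le hδ hm (by omega : m ≤ n) (by omega)) hy ?_
      simp only [turn, edgeForm] at e'' ⊢
      set r := landing τ δ n
      set s := landing τ δ (n + 1)
      set W := (step τ δ)^[n + 1] Z
      have e3 : s * ((r + 1) * W.2 + r * W.1 - r * (r + 1)) =
          r * ((r + 1 - 0) * (W.2 - s) - (0 - s) * (W.1 - 0))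
            + (s - r) * ((r + 1) * W.2) := by ring
      have p1 := mul_nonneg hs0 e''
      have p2 : 0 ≤ (s - r) * ((r + 1) * W.2) :=
        mul_nonneg (by linarith) (mul_nonneg (by linarith) hy)
      exact nonneg_of_mul_nonneg_right (by rw [e3]; linarith) (hs0.trans_lt hs)

end LucasPos

/-! ### Itineraries of `f` and the induced map. -/

theorem fL_eq_step (P : BCNF) : P.fL = step P.τL P.δL := rfl

theorem fR_eq_step (P : BCNF) : P.fR = step P.τR P.δR := rfl

theorem f_of_nonpos (P : BCNF) {z : ℝ × ℝ} (h : z.1 ≤ 0) : P.f z = P.fL z := if_pos h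

theorem f_of_nonneg (P : BCNF) {z : ℝ × ℝ} (h : 0 ≤ z.1) : P.f z = P.fR z := by
  rcases h.lt_or_eq with h | h
  · exact if_neg (not_le.mpr h)
  · rw [f_of_nonpos P h.ge]; simp [fL, fR, ← h]

theorem f_iterate_eq_fL (P : BCNF) {z : ℝ × ℝ} {n : ℕ}
    (h : ∀ i < n, ((step P.τL P.δL)^[i] z).1 ≤ 0) {k : ℕ} (hk : k ≤ n) :
    P.f^[k] z = (step P.τL P.δL)^[k] z := by
  induction k with
  | zero => rfl
  | succ k ih =>
    rw [Function.iterate_succ_apply', Function.iterate_succ_apply', ih (by omega),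
      P.f_of_nonpos (h k hk), P.fL_eq_step]

theorem f_iterate_eq_fR (P : BCNF) {z : ℝ × ℝ} {n : ℕ}
    (h : ∀ i < n, 0 ≤ ((step P.τR P.δR)^[i] z).1) {k : ℕ} (hk : k ≤ n) :
    P.f^[k] z = (step P.τR P.δR)^[k] z := by
  induction k with
  | zero => rfl
  | succ k ih =>
    rw [Function.iterate_succ_apply', Function.iterate_succ_apply', ih (by omega),
      P.f_of_nonneg (h k hk), P.fR_eq_step]

theorem chiL_eq (P : BCNF) {z : ℝ × ℝ} {n : ℕ} (hn : 1 ≤ n)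
    (h : ∀ i < n, ((step P.τL P.δL)^[i] z).1 ≤ 0) (hpos : 0 < ((step P.τL P.δL)^[n] z).1) :
    (P.exitsL z).Nonempty ∧ P.chiL z = n := by
  have hmem : n ∈ P.exitsL z := by
    refine ⟨hn, ?_⟩
    rw [P.f_iterate_eq_fL h le_rfl]
    exact not_le.mpr hpos
  refine ⟨⟨n, hmem⟩, le_antisymm (Nat.sInf_le hmem) (le_csInf ⟨n, hmem⟩ ?_)⟩
  rintro i ⟨-, hi⟩
  by_contra! hc
  rw [P.f_iterate_eq_fL h hc.le] at hi
  exact hi (h i hc)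

theorem chiR_eq (P : BCNF) {z : ℝ × ℝ} {n : ℕ} (hn : 1 ≤ n)
    (h : ∀ i < n, 0 ≤ ((step P.τR P.δR)^[i] z).1) (hneg : ((step P.τR P.δR)^[n] z).1 < 0) :
    (P.exitsR z).Nonempty ∧ P.chiR z = n := by
  have hmem : n ∈ P.exitsR z := by
    refine ⟨hn, ?_⟩
    rw [P.f_iterate_eq_fR h le_rfl]
    exact not_le.mpr hneg
  refine ⟨⟨n, hmem⟩, le_antisymm (Nat.sInf_le hmem) (le_csInf ⟨n, hmem⟩ ?_)⟩
  rintro i ⟨-, hi⟩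
  by_contra! hc
  rw [P.f_iterate_eq_fR h hc.le] at hi
  exact hi (h i hc)

theorem coefK_eq (P : BCNF) (i : ℕ) : P.coefK i = lucasSum P.τL P.δL i := by
  simp [coefK, fL_eq_step, step_iterate_fst]

theorem coefA_eq (P : BCNF) (i : ℕ) : P.coefA i = lucas P.τL P.δL (i + 1) := by
  simp [coefA, coefK_eq, fL_eq_step, step_iterate_fst]

theorem coefB_eq (P : BCNF) (i : ℕ) : P.coefB i = lucas P.τL P.δL i := by
  simp [coefB, coefK_eq, fL_eq_step, step_iterate_fst]

theorem yInt_eq (P : BCNF) (i : ℕ) : P.yInt i = intercept P.τL P.δL i := by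
  rw [yInt, coefK_eq, coefB_eq, intercept]

/-- For i < p^* the slope -U_{i+1}/U_i is negative, so positivity passes from U_i to U_{i+1}. -/
theorem lucasPos_of_le_pStar (P : BCNF) {M : ℕ} (hM : (M : ℕ∞) ≤ P.pStar) :
    LucasPos P.τL P.δL M := by
  intro i h1
  induction i, h1 using Nat.le_induction with
  | base => intro _; simp [lucas]
  | succ i h1 ih =>
    intro hi
    have hpos := ih (by omega)
    by_contra! hc
    have hs : 0 ≤ P.slope i := by
      rw [slope, coefA_eq, coefB_eq]
      exact div_nonneg (neg_nonneg.2 hc) hpos.le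
    have hline : P.IsPreLine i (P.slope i) (P.yInt i) :=
      (P.isPreLine_iff i _ _).2 ⟨by rw [coefB_eq]; exact hpos.ne', rfl, rfl⟩
    have : P.pStar ≤ (i : ℕ∞) := sInf_le ⟨i, h1, ⟨_, _, hline, hs⟩, rfl⟩
    have := hM.trans this
    norm_cast at this
    omega

/-- The itinerary of a corner of `Ω` up to its return to `Φ`. -/
theorem corner_itinerary (P : BCNF) (hδL : 0 < P.δL) (hδR : 0 < P.δR) {M p : ℕ}
    (h : LucasPos P.τL P.δL M) (h1 : 1 ≤ p) (hM : p ≤ M)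
    (hpre : P.f (P.corner p) ∈ P.PhiPre) :
    1 ≤ P.chiRL (P.corner p) ∧
    ExitsAt P.τR P.δR (landing P.τL P.δL p) (P.chiRL (P.corner p)) ∧
    P.FLR (P.corner p) = orb P.τR P.δR (landing P.τL P.δL p) (P.chiRL (P.corner p) + 1) ∧
    P.crossing (P.corner p) =
      meetSigma (orb P.τR P.δR (landing P.τL P.δL p) (P.chiRL (P.corner p) + 1))
        (orb P.τR P.δR (landing P.τL P.δL p) (P.chiRL (P.corner p))) := by
  set s := landing P.τL P.δL p with hsdef
  have hs : 0 ≤ s := h.landing_nonneg hδL h1 hM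
  have hcor : P.corner p = (0, intercept P.τL P.δL p) := by rw [corner, yInt_eq]
  set z := P.corner p
  have horb : ∀ i, (step P.τL P.δL)^[i] z = orb P.τL P.δL (intercept P.τL P.δL p) i := by
    intro i; rw [hcor]; rfl
  have hneg : ∀ i, 1 ≤ i → i < p → ((step P.τL P.δL)^[i] z).1 < 0 := by
    intro i hi hip
    rw [horb, h.orb_fst_eq hi (by omega)]
    exact mul_neg_of_pos_of_neg (h i hi (by omega))
      (sub_neg.2 (h.intercept_lt hδL hi hip hM))
  have hle : ∀ i < p + 1, ((step P.τL P.δL)^[i] z).1 ≤ 0 := by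
    intro i hi
    rcases Nat.eq_zero_or_pos i with rfl | hi0
    · rw [horb, orb_zero]
    rcases Nat.lt_succ_iff_lt_or_eq.mp hi with hip | rfl
    · exact (hneg i hi0 hip).le
    · rw [horb, h.orb_intercept h1 hM]
  have hend : (step P.τL P.δL)^[p + 1] z = (s + 1, 0) := by
    rw [horb, h.orb_intercept_succ h1 hM]
  -- The corner returns to Σ at time p, still inside the closed `PiL`, so it exits only at time p +
  -- 1, at (s + 1, 0).
  have hchi : P.chiL z = p + 1 := (P.chiL_eq (by omega) hle (by rw [hend]; simp; linarith)).2
  have hchi' : P.fL^[P.chiL z] z = (s + 1, 0) := by rw [hchi, P.fL_eq_step, hend]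
  have hR : ∀ j, (step P.τR P.δR)^[j] (s + 1, 0) = orb P.τR P.δR s (j + 1) := by
    intro j
    rw [orb, Function.iterate_succ_apply]
    simp [step]
  -- The visit to `Phi` cannot occur before the corner reaches (s + 1, 0), since ordinates are
  -- positive until then; it forces the right orbit to leave x ≥ 0.
  have hex : ∃ N, (orb P.τR P.δR s N).1 < 0 := by
    simp only [PhiPre, mem_iUnion, mem_preimage, mem_Ici] at hpre
    obtain ⟨n, hn, hphi⟩ := hpre
    rw [← Function.iterate_succ_apply] at hphi
    have hnp : p + 1 < n + 1 := by
      by_contra! hc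
      rw [Nat.succ_eq_add_one, P.f_iterate_eq_fL hle hc] at hphi
      rcases hc.lt_or_eq with hc | hc
      · have h2 := hphi.2
        rw [step_iterate_succ_snd] at h2
        nlinarith [hneg n hn (by omega)]
      · rw [hc, hend] at hphi
        have := hphi.1
        simp only at this
        linarith
    obtain ⟨j, hj⟩ := Nat.exists_eq_add_of_le hnp.le
    rw [Nat.succ_eq_add_one, hj, add_comm, Function.iterate_add_apply,
      P.f_iterate_eq_fL hle le_rfl, hend] at hphi
    by_contra! hall
    rw [P.f_iterate_eq_fR (n := j) (fun i _ => by rw [hR]; exact hall _) le_rfl, hR] at hphi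
    exact absurd hphi.1 (not_lt.mpr (hall _))
  obtain ⟨N, hN⟩ := hex
  obtain ⟨q, -, hst, hexit⟩ := exists_first_exit hN
  have hq : 1 ≤ q := by
    by_contra! hc
    obtain rfl : q = 0 := by omega
    rw [zero_add, orb_one] at hexit
    simp only at hexit
    linarith
  have hchiR : P.chiRL z = q := by
    rw [chiRL, hchi']
    refine (P.chiR_eq hq (fun i hi => ?_) ?_).2
    · rw [hR]; exact hst _ hi
    · rw [hR]; exact hexit
  have hF : P.FLR z = orb P.τR P.δR s (q + 1) := by
    rw [FLR, hchi', hchiR, P.fR_eq_step, hR]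
  rw [hchiR]
  refine ⟨hq, ⟨hδR, hs, hst, hexit⟩, hF, ?_⟩
  rw [crossing, hF]
  congr 1
  rw [orb_succ, ← P.fR_eq_step, ← P.f_of_nonneg (hst q le_rfl), P.fInv_f hδL hδR]

theorem meetSigma_snd_sub (A B : ℝ × ℝ) (c : ℝ) (h : A.1 < B.1) :
    (B.1 - A.1) * ((meetSigma A B).2 - c) = B.1 * (A.2 - c) - A.1 * (B.2 - c) := by
  have : B.1 - A.1 ≠ 0 := (sub_pos.2 h).ne'
  simp only [meetSigma]
  field_simp
  ring

theorem f_corner (P : BCNF) (p : ℕ) : P.f (P.corner p) = (P.yInt p + 1, 0) := by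
  rw [f_of_nonpos P (by simp [corner])]
  simp [fL, corner]

theorem le_edge_iff {c : ℝ} (hc : c < 0) (z : ℝ × ℝ) :
    (c + 1) / c * (c - z.2) ≤ z.1 ↔ edgeForm c z ≤ 0 := by
  rw [div_mul_eq_mul_div, div_le_iff_of_neg hc, edgeForm]
  constructor <;> intro h <;> linarith

theorem edge_le_iff {c : ℝ} (hc : c < 0) (z : ℝ × ℝ) :
    z.1 ≤ (c + 1) / c * (c - z.2) ↔ 0 ≤ edgeForm c z := by
  rw [div_mul_eq_mul_div, le_div_iff_of_neg hc, edgeForm]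
  constructor <;> intro h <;> linarith

/-- The return time to `Φ` of a point of `Φ` that makes one excursion through each half-plane. -/
theorem returnTime_eq (P : BCNF) (hδL : 0 < P.δL) (hδR : 0 < P.δR) {Z : ℝ × ℝ} {p j : ℕ}
    (hZ : Z ∈ Phi) (hp : 1 ≤ p) (hj : 1 ≤ j)
    (hL : ∀ i < p, ((step P.τL P.δL)^[i] Z).1 ≤ 0)
    (hR : ∀ i < j, 0 ≤ ((step P.τR P.δR)^[i] ((step P.τL P.δL)^[p] Z)).1)
    (hRj : ((step P.τR P.δR)^[j] ((step P.τL P.δL)^[p] Z)).1 < 0) :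
    Z ∈ P.PhiPre ∧ P.returnTime Z = p + j ∧
      P.F Z = (step P.τR P.δR)^[j] ((step P.τL P.δL)^[p] Z) ∧ P.F Z ∈ Phi := by
  set W := (step P.τL P.δL)^[p] Z with hW
  have hfR : ∀ i ≤ j, P.f^[p + i] Z = (step P.τR P.δR)^[i] W := fun i hi => by
    rw [add_comm, Function.iterate_add_apply, P.f_iterate_eq_fL hL le_rfl, ← hW,
      P.f_iterate_eq_fR hR hi]
  have hphi : (step P.τR P.δR)^[j] W ∈ Phi := by
    refine ⟨hRj, ?_⟩
    obtain ⟨n, rfl⟩ : ∃ n, j = n + 1 := ⟨j - 1, by omega⟩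
    rw [step_iterate_succ_snd]
    nlinarith [hR n (by omega)]
  have hmem : p + j ∈ {n : ℕ | 1 ≤ n ∧ P.f^[n] Z ∈ Phi} :=
    ⟨by omega, by rw [hfR j le_rfl]; exact hphi⟩
  -- From a point (0, y) with y ≥ 0 the next abscissa y + 1 is positive, so the axis can be met only
  -- just before the exit.
  have hneg : ∀ i < p, ((step P.τL P.δL)^[i] Z).1 = 0 → 0 < i → i + 1 = p := by
    intro i hi h0 hi0
    by_contra hne
    obtain ⟨k, rfl⟩ : ∃ k, i = k + 1 := ⟨i - 1, by omega⟩
    have h2 := hL (k + 1 + 1) (by omega)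
    have h3 : 0 ≤ ((step P.τL P.δL)^[k + 1] Z).2 := by
      rw [step_iterate_succ_snd]; nlinarith [hL k (by omega)]
    rw [Function.iterate_succ_apply', step, h0] at h2
    simp only at h2
    linarith
  have htime : P.returnTime Z = p + j := by
    refine le_antisymm (Nat.sInf_le hmem) (le_csInf ⟨_, hmem⟩ ?_)
    rintro n ⟨hn1, hn⟩
    by_contra! hc
    rcases lt_or_ge n p with hnp | hnp
    · rw [P.f_iterate_eq_fL hL hnp.le] at hn
      obtain ⟨k, rfl⟩ : ∃ k, n = k + 1 := ⟨n - 1, by omega⟩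
      have h2 := hn.2
      rw [step_iterate_succ_snd] at h2
      have hk := hL k (by omega)
      have hk0 : ((step P.τL P.δL)^[k] Z).1 = 0 := by
        by_contra hne
        have := lt_of_le_of_ne hk hne
        nlinarith
      rcases Nat.eq_zero_or_pos k with rfl | hkpos
      · exact hZ.1.ne hk0
      · have := hneg k (by omega) hk0 hkpos
        omega
    · obtain ⟨i, rfl⟩ := Nat.exists_eq_add_of_le hnp
      rw [hfR i (by omega)] at hn
      exact absurd hn.1 (not_lt.mpr (hR i (by omega)))
  have hF : P.F Z = (step P.τR P.δR)^[j] W := by rw [F, htime, hfR j le_rfl]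
  refine ⟨?_, htime, hF, hF ▸ hphi⟩
  simp only [PhiPre, mem_iUnion, mem_preimage, mem_Ici]
  exact ⟨p + j, hmem.1, hmem.2⟩

end BCNF

/-! ### Assembly of the two passages. -/

open BCNF in
theorem proposition4p1 (P : BCNF) (hτL : 0 < P.τL) (hδL : 0 < P.δL) (hδR : 0 < P.δR)
    (pmin pmax : ℕ) (hp1 : 1 ≤ pmin) (hp2 : pmin < pmax) (hp3 : (pmax : ℕ∞) ≤ P.pStar)
    (S T U V : ℝ × ℝ) (hS : S = P.corner pmax) (hT : T = P.corner pmin)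
    (hSpre : P.f S ∈ P.PhiPre) (hTpre : P.f T ∈ P.PhiPre)
    (hU : U = P.crossing S) (hV : V = P.crossing T)
    (qmin qmax : ℕ) (hqmin : qmin = min (P.chiRL S) (P.chiRL T))
    (hqmax : qmax = max (P.chiRL S) (P.chiRL T) + 1)
    (hUS : S.2 < U.2)
    (hVT : V.2 < T.2)
    (hFS : (P.f S).1 * (P.FLR S).2 + S.2 * (P.FLR S).1 < (P.f S).1 * S.2)
    (hFT : (P.f T).1 * T.2 < (P.f T).1 * (P.FLR T).2 + T.2 * (P.FLR T).1) :
    P.Omega pmin pmax ⊆ P.Phi0 ∧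
    Set.MapsTo P.F (P.Omega pmin pmax) (P.Omega pmin pmax) ∧
    ∀ Z ∈ P.Omega pmin pmax,
      (P.exitsL Z).Nonempty ∧ pmin ≤ P.chiL Z ∧ P.chiL Z ≤ pmax ∧
      (P.exitsR (P.fL^[P.chiL Z] Z)).Nonempty ∧
      qmin ≤ P.chiR (P.fL^[P.chiL Z] Z) ∧ P.chiR (P.fL^[P.chiL Z] Z) ≤ qmax := by
  have hpos := P.lucasPos_of_le_pStar hp3
  obtain ⟨hqS, hES, hFSeq, hCS⟩ :=
    P.corner_itinerary hδL hδR hpos (by omega : 1 ≤ pmax) le_rfl (hS ▸ hSpre)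
  obtain ⟨hqT, hET, hFTeq, hCT⟩ :=
    P.corner_itinerary hδL hδR hpos hp1 hp2.le (hT ▸ hTpre)
  subst hS hT hU hV
  have hcS := hpos.intercept_lt_neg_one hδL (by omega : 1 < pmax) le_rfl
  have hcT := hpos.intercept_le_neg_one hδL hp1 hp2.le
  have hts := hpos.landing_lt hδL hp1 hp2 le_rfl
  have ht := hpos.landing_nonneg hδL hp1 hp2.le
  rw [f_corner, hFSeq] at hFS
  rw [f_corner, hFTeq] at hFT
  rw [hCS] at hUS
  rw [hCT] at hVT
  have hcor : ∀ p, (P.corner p).2 = intercept P.τL P.δL p := P.yInt_eq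
  simp only [hcor, yInt_eq] at hUS hVT hFS hFT
  set qS := P.chiRL (P.corner pmax)
  set qT := P.chiRL (P.corner pmin)
  set c := intercept P.τL P.δL pmax
  set c' := intercept P.τL P.δL pmin
  set s := landing P.τL P.δL pmax
  set t := landing P.τL P.δL pmin
  -- The line defining U carries the edge on which the orbit of S leaves the right half-plane; `hUS`
  -- places its crossing above S, and `hFS` is the sign of `edgeForm c` at F(S).
  have hpS : PassesAbove c (orb P.τR P.δR s qS) (orb P.τR P.δR s (qS + 1)) := by
    have hlt := hES.exit.trans_le (hES.stays qS le_rfl)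
    refine ⟨by simp only [edgeForm]; linarith, ?_⟩
    rw [← meetSigma_snd_sub _ _ _ hlt]
    exact mul_pos (sub_pos.2 hlt) (sub_pos.2 hUS)
  have hpT : PassesBelow c' (orb P.τR P.δR t qT) (orb P.τR P.δR t (qT + 1)) := by
    have hlt := hET.exit.trans_le (hET.stays qT le_rfl)
    refine ⟨by simp only [edgeForm]; linarith, ?_⟩
    rw [← meetSigma_snd_sub _ _ _ hlt]
    exact mul_neg_of_pos_of_neg (sub_pos.2 hlt) (sub_neg.2 hVT)
  have hOmega : ∀ Z, Z ∈ P.Omega pmin pmax ↔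
      Z ∈ Phi ∧ edgeForm c Z ≤ 0 ∧ 0 ≤ edgeForm c' Z := fun Z => by
    simp only [Omega, mem_ofPred_eq, yInt_eq]
    rw [le_edge_iff (by linarith : c < 0), edge_le_iff (by linarith : c' < 0)]
  have main : ∀ Z ∈ P.Omega pmin pmax, Z ∈ P.Phi0 ∧ P.F Z ∈ P.Omega pmin pmax ∧
      (P.exitsL Z).Nonempty ∧ pmin ≤ P.chiL Z ∧ P.chiL Z ≤ pmax ∧
      (P.exitsR (P.fL^[P.chiL Z] Z)).Nonempty ∧
      qmin ≤ P.chiR (P.fL^[P.chiL Z] Z) ∧ P.chiR (P.fL^[P.chiL Z] Z) ≤ qmax := by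
    intro Z hZ
    obtain ⟨hphi, hZS, hZT⟩ := (hOmega Z).1 hZ
    obtain ⟨p, hmp, hpM, hL, hLp, hW2, hWS, hWT⟩ :=
      hpos.exists_departure hδL hp1 hp2 hphi.1 hphi.2 hZS hZT
    obtain ⟨j, hqj, hjQ, hR, hRj, hGS, hGT⟩ := exists_return hqS hts.le (ht.trans_lt hts)
      (by linarith) (by linarith) hET hES hpT hpS hLp hW2
      (by simp only [edgeForm] at hWT; linarith) (by simp only [edgeForm] at hWS; linarith)
    obtain ⟨hpre, -, hF, hFphi⟩ :=
      P.returnTime_eq hδL hδR hphi (by omega) (by omega) hL hR hRj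
    obtain ⟨hexL, hchiL⟩ := P.chiL_eq (by omega) hL hLp
    obtain ⟨hexR, hchiR⟩ := P.chiR_eq (by omega) hR hRj
    rw [hchiL, P.fL_eq_step, hchiR]
    refine ⟨⟨hpre, hphi⟩, (hOmega _).2 ⟨hFphi, ?_, ?_⟩, hexL, hmp, hpM, hexR, ?_, ?_⟩
    · rw [hF]; exact hGS
    · rw [hF]; exact hGT
    · rw [hqmin]; exact (min_le_left _ _).trans hqj
    · rw [hqmax]; exact hjQ.trans (Nat.add_le_add_right (le_max_right _ _) 1)
  exact ⟨fun Z hZ => (main Z hZ).1, fun Z hZ => (main Z hZ).2.1,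
    fun Z hZ => (main Z hZ).2.2⟩
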